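/- Let $n\ge 0$, $[n]=\{1,\dots,n\}$. A building set $\mathcal B$ on $[n]$ is a collection of nonempty subsets of $[n]$ that contains all singletons and such that $I\cup J\in\mathcal B$ whenever $I,J\in\mathcal B$ and $I\cap J\neq\varnothing$. It is chordal if for every $I=\{i_1<\dots<i_r\}\in\mathcal B$ and every $1\le s\le r$ also $\{i_s,\dots,i_r\}\in\mathcal B$. For $S\subseteq[n]$ put $\mathcal B|_S=\{I\in\mathcal B: I\subseteq S\}$; the connected components of $\mathcal B|_S$ are its inclusion-maximal elements. The extended nested complex $\mathcal N^\square(\mathcal B)$ is the simplicial complex with vertices the $I\in\mathcal B$ and formal symbols $x_i$ $(i\in[n])$, whose faces are the sets $\{I_1,\dots,I_p,x_{i_1},\dots,x_{i_q}\}$ (with $I_1,\dots,I_p$ distinct, $p,q\ge0$) such that any two $I_j$ are nested or disjoint, no union of at least two pairwise disjoint $I_j$'s lies in $\mathcal B$, and $i_k\notin I_j$ for all $j,k$. An extended nestohedron $\mathcal P^\square(\mathcal B)$ is a convex polytope dual to $\mathcal N^\square(\mathcal B)$: its nonempty faces (itself included) correspond, by an inclusion-reversing bijection, to the faces of $\mathcal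 N^\square(\mathcal B)$ (the empty face included). For a $d$-dimensional polytope $P$ with $f_i(P)$ faces of dimension $i$, put $f_P(t)=\sum_{i=0}^d f_i(P)t^i$ and define the $h$-polynomial by $f_P(t)=h_P(t+1)$. A partial permutation of $[n]$ is a word $w=(w_1,\dots,w_k)$, $0\le k\le n$, with distinct letters in $[n]$. It is a $\mathcal B$-partial permutation if for every $1\le i\le k$ the elements $w_i$ and $\max\{w_1,\dots,w_i\}$ lie in the same connected component of $\mathcal B|_{\{w_1,\dots,w_i\}}$. Let $\varphi_n(w)\in\mathfrak S_{n+1}$ be the permutation whose one-line notation is $w$ followed by the elements of $[n+1]\setminus\{w_1,\dots,w_k\}$ in decreasing order, and let $\mathfrak S^\square_{n+1}(\mathcal B)$, the set of extended $\mathcal B$-permutations, be the image under $\varphi_n$ of the set of $\mathcal B$-partial permutations. For $w\in\mathfrak S_{n+1}$ let $\operatorname{des}(w)=|\{i\in[n]: w(i)>w(i+1)\}|$. Theorem. Let $\mathcal B$ be a chordal building set on $[n]$. Then an extended nestohedron $\mathcal P^\square(\mathcal B)$ exists in $\mathbb R^n$, and every extended nestohedron $\mathcal P^\square(\mathcal B)$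 (in any $\mathbb R^m$) satisfies $$h_{\mathcal P^\square(\mathcal B)}(t)=\sum_{w\in\mathfrak S^\square_{n+1}(\mathcal B)}t^{\operatorname{des}(w)}.$$ -/

import Mathlib

/-! Conventions: `Fin n` with its usual order stands for `[n] = {1 < ⋯ < n}`, `Fin (n + 1)` for
`[n + 1]`, and `Fin.castSucc : Fin n → Fin (n + 1)` for the inclusion `[n] ⊆ [n + 1]`. -/

namespace ExtNest

/-! ### Building sets -/

/-- A building set on `[n]`: a collection of nonempty subsets containing all singletons and closed
under unions of intersecting members. -/
structure IsBuildingSet {n : ℕ} (B : Finset (Finset (Fin n))) : Prop where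
  nonempty : ∀ I ∈ B, I.Nonempty
  singleton : ∀ i : Fin n, {i} ∈ B
  union : ∀ I ∈ B, ∀ J ∈ B, (I ∩ J).Nonempty → I ∪ J ∈ B

/-- `B` is chordal: with `I = {i₁ < ⋯ < iᵣ}` it contains every `{iₛ < ⋯ < iᵣ}`, `1 ≤ s ≤ r`. -/
def IsChordal {n : ℕ} (B : Finset (Finset (Fin n))) : Prop :=
  ∀ I ∈ B, ∀ a ∈ I, I.filter (fun b => a ≤ b) ∈ B

/-- The restriction `B|_S` of a building set to `S`. -/
def restrict {n : ℕ} (B : Finset (Finset (Fin n))) (S : Finset (Fin n)) :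
    Finset (Finset (Fin n)) :=
  B.filter (fun I => I ⊆ S)

/-- `a` and `b` lie in the same connected component of `B`, that is, in a common maximal (under
inclusion) element of `B`. -/
def SameComponent {n : ℕ} (B : Finset (Finset (Fin n))) (a b : Fin n) : Prop :=
  ∃ M : Finset (Fin n), Maximal (fun I => I ∈ B) M ∧ a ∈ M ∧ b ∈ M

/-! ### The extended nested complex -/

/-- Extended nested collections: finite sets `N` of vertices, where a vertex is either a member `I`
of the building set, written `Sum.inl I`, or a design vertex `x_i`, written `Sum.inr i`. -/
structure IsExtendedNested {n : ℕ} (B : Finset (Finset (Fin n)))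
    (N : Finset (Finset (Fin n) ⊕ Fin n)) : Prop where
  mem : ∀ I, Sum.inl I ∈ N → I ∈ B
  disjoint_or_nested : ∀ I J, Sum.inl I ∈ N → Sum.inl J ∈ N → I ⊆ J ∨ J ⊆ I ∨ Disjoint I J
  union_notMem : ∀ T : Finset (Finset (Fin n)), (∀ I ∈ T, Sum.inl I ∈ N) → 2 ≤ T.card →
    (T : Set (Finset (Fin n))).PairwiseDisjoint id → T.sup id ∉ B
  design : ∀ I i, Sum.inl I ∈ N → Sum.inr i ∈ N → i ∉ I

/-- The face poset of the extended nested complex of `B` (the empty face included), ordered by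
inclusion. -/
abbrev ExtendedNestedComplex {n : ℕ} (B : Finset (Finset (Fin n))) : Type :=
  {N : Finset (Finset (Fin n) ⊕ Fin n) // IsExtendedNested B N}

/-! ### Polytopes, their faces, f- and h-polynomials -/

/-- Convex polytopes in `ℝᵐ`: convex hulls of finite sets. -/
def IsPolytope {m : ℕ} (P : Set (EuclideanSpace ℝ (Fin m))) : Prop :=
  ∃ s : Finset (EuclideanSpace ℝ (Fin m)), P = convexHull ℝ (s : Set (EuclideanSpace ℝ (Fin m)))

/-- Nonempty faces of `P`: the nonempty sets of maximisers on `P` of a linear functional. The zero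
functional gives `P` itself. -/
def IsFace {m : ℕ} (P F : Set (EuclideanSpace ℝ (Fin m))) : Prop :=
  IsExposed ℝ P F ∧ F.Nonempty

/-- The dimension of a (nonempty) set: that of its affine span. -/
noncomputable def dim {m : ℕ} (F : Set (EuclideanSpace ℝ (Fin m))) : ℕ :=
  Module.finrank ℝ (affineSpan ℝ F).direction

/-- The number `f_i(P)` of `i`-dimensional faces of `P`. -/
noncomputable def faceNumber {m : ℕ} (P : Set (EuclideanSpace ℝ (Fin m))) (i : ℕ) : ℕ :=
  Set.ncard {F : Set (EuclideanSpace ℝ (Fin m)) | IsFace P F ∧ dim F = i}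

/-- The `f`-polynomial `∑_{i ≤ dim P} f_i(P) tⁱ`. -/
noncomputable def fPoly {m : ℕ} (P : Set (EuclideanSpace ℝ (Fin m))) : Polynomial ℤ :=
  ∑ i ∈ Finset.range (dim P + 1), Polynomial.C (faceNumber P i : ℤ) * Polynomial.X ^ i

/-- The `h`-polynomial, the unique polynomial with `f_P(t) = h_P(t + 1)`. -/
noncomputable def hPoly {m : ℕ} (P : Set (EuclideanSpace ℝ (Fin m))) : Polynomial ℤ :=
  (fPoly P).comp (Polynomial.X - 1)

theorem hPoly_comp {m : ℕ} (P : Set (EuclideanSpace ℝ (Fin m))) :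
    (hPoly P).comp (Polynomial.X + 1) = fPoly P := by
  simp [hPoly, Polynomial.comp_assoc]

/-- `P` is an extended nestohedron of `B`: a polytope that is combinatorially dual to a simplicial
polytope with boundary complex the extended nested complex, i.e. the nonempty faces of `P` correspond
to the extended nested collections by an inclusion-reversing bijection (with `P` itself corresponding
to the empty collection). -/
def IsExtendedNestohedron {n m : ℕ} (B : Finset (Finset (Fin n)))
    (P : Set (EuclideanSpace ℝ (Fin m))) : Prop :=
  IsPolytope P ∧
    Nonempty ({F : Set (EuclideanSpace ℝ (Fin m)) // IsFace P F} ≃o (ExtendedNestedComplex B)ᵒᵈ)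

/-! ### Partial permutations and extended `B`-permutations -/

/-- Partial permutations of `[n]`: words without repeated letters. Such a word `w` is the one-line
notation of a permutation of its set of letters. -/
abbrev PartialPerm (n : ℕ) : Type := {w : List (Fin n) // w.Nodup}

/-- `B`-partial permutations: for each position `i`, the letter `w_i` and the largest of
`w_1, …, w_i` lie in the same connected component of `B|_{w_1, …, w_i}`. -/
def IsBPartialPerm {n : ℕ} (B : Finset (Finset (Fin n))) (w : PartialPerm n) : Prop :=
  ∀ (i : ℕ) (hi : i < w.1.length) (M : Fin n),
    IsGreatest {a : Fin n | a ∈ w.1.take (i + 1)} M →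
      SameComponent (restrict B (w.1.take (i + 1)).toFinset) w.1[i] M

/-- The word obtained from `w` by appending the letters of `[n + 1]` missing from `w` in decreasing
order. -/
def phiWord {n : ℕ} (w : PartialPerm n) : List (Fin (n + 1)) :=
  w.1.map Fin.castSucc ++
    (Finset.univ \ (w.1.map Fin.castSucc).toFinset).sort (fun a b => b ≤ a)

theorem phiWord_nodup {n : ℕ} (w : PartialPerm n) : (phiWord w).Nodup := by
  refine List.Nodup.append (w.2.map (Fin.castSucc_injective n)) (Finset.sort_nodup _ _) ?_
  intro a ha hb
  simp only [Finset.mem_sort, Finset.mem_sdiff, List.mem_toFinset] at hb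
  exact hb.2 ha

theorem mem_phiWord {n : ℕ} (w : PartialPerm n) (a : Fin (n + 1)) : a ∈ phiWord w := by
  simp only [phiWord, List.mem_append, Finset.mem_sort, Finset.mem_sdiff, Finset.mem_univ,
    List.mem_toFinset, true_and]
  exact em _

theorem phiWord_length {n : ℕ} (w : PartialPerm n) : (phiWord w).length = n + 1 := by
  have h : (phiWord w).toFinset = Finset.univ :=
    Finset.eq_univ_iff_forall.2 fun a => List.mem_toFinset.2 (mem_phiWord w a)
  rw [← List.toFinset_card_of_nodup (phiWord_nodup w), h, Finset.card_univ, Fintype.card_fin]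

/-- The map `φ_n` from partial permutations of `[n]` to permutations of `[n + 1]`: `φ_n(w)` is the
permutation with one-line notation `phiWord w`. -/
def phi {n : ℕ} (w : PartialPerm n) : Equiv.Perm (Fin (n + 1)) :=
  (finCongr (phiWord_length w).symm).trans
    ((phiWord_nodup w).getEquivOfForallMemList (phiWord w) (mem_phiWord w))

theorem phi_apply {n : ℕ} (w : PartialPerm n) (i : Fin (n + 1)) :
    phi w i = (phiWord w)[(i : ℕ)]'((phiWord_length w).symm ▸ i.2) := rfl

open Classical in
/-- The extended `B`-permutations, i.e. the image under `φ_n` of the `B`-partial permutations. -/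
noncomputable def extendedBPermutations {n : ℕ} (B : Finset (Finset (Fin n))) :
    Finset (Equiv.Perm (Fin (n + 1))) :=
  Finset.univ.filter (fun σ => σ ∈ phi '' {w : PartialPerm n | IsBPartialPerm B w})

/-- The number of descents of a permutation `σ` of `[n + 1]`: positions `i` with
`σ(i) > σ(i + 1)`. -/
def des {n : ℕ} (σ : Equiv.Perm (Fin (n + 1))) : ℕ :=
  (Finset.univ.filter (fun i : Fin n => σ i.succ < σ i.castSucc)).card

end ExtNest

/-! The identity amounts to $f_P(t)=\sum_w (t+1)^{\operatorname{des}(w)}$. Both sides are split over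
subsets $U\subseteq[n]$: the union of the building set members of an extended nested collection on
the left, the set of letters of a partial permutation on the right.

Polytope side: face dimension is combinatorial, since it rises by exactly one along covers and
minimal faces are points. Hence the face of a collection $N$ has dimension $n-|N|$, where $n$ is
read off an explicit realization (`IsBuildingSet.exists_isExtendedNestohedron`), which also proves
existence. It is cut out by $\sum_{i\in I}x_i\ge (n+2)^{|I|}-1$ and $x_i\le (n+2)^n+1$; the possible
sets of tight inequalities are exactly the extended nested collections. The design vertices form an
arbitrary subset of the complement of $U$, which gives a factor $(t+1)^{n-|U|}$
(`sum_isExtendedNested`).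

Word side: $\varphi_n(w)$ has $\operatorname{des}(w)+n-k$ descents, where $k=|U|$ is the length of
$w$, so the same factor appears (`sum_extendedBPermutations`).

What remains is an equality for each $U$ (`nestedPoly_eq_wordPoly`). Let $K$ be the component of
$a=\max U$ in $\mathcal B|_U$. A nested collection with union $U$ contains $K$, and deleting $K$
leaves one with union $U\setminus C$, where $C$ can be any nonempty subset of $K$ (`nestedPoly_eq`).
For reversed words, $(t+1)^{\mathrm{asc}}$ expands over the ways to cut the word into increasing
blocks, and chordality reduces the condition on the first block to its letters lying in $K$
(`wordPoly_eq`). Both polynomials therefore satisfy the same recursion. -/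

namespace ExtNest

/-! ### Exposed faces of polytopes and the combinatorial nature of their dimension. -/

section Faces
variable {m : ℕ} {P F G H : Set (EuclideanSpace ℝ (Fin m))}

theorem IsFace.subset (hF : IsFace P F) : F ⊆ P := hF.1.subset

/-- A face is cut out by a supporting functional. -/
theorem IsFace.exists_functional (hF : IsFace P F) :
    ∃ l : StrongDual ℝ (EuclideanSpace ℝ (Fin m)), ∃ p ∈ F, (∀ y ∈ P, l y ≤ l p) ∧
      ∀ x, x ∈ F ↔ x ∈ P ∧ l x = l p := by
  obtain ⟨p, hp⟩ := hF.2
  obtain ⟨l, rfl⟩ := hF.1 hF.2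
  refine ⟨l, p, hp, hp.2, fun x => ⟨fun hx => ⟨hx.1, le_antisymm (hp.2 x hx.1) (hx.2 p hp.1)⟩,
    fun hx => ⟨hx.1, fun y hy => hx.2 ▸ hp.2 y hy⟩⟩⟩

theorem isFace_of_functional (l : StrongDual ℝ (EuclideanSpace ℝ (Fin m)))
    {p : EuclideanSpace ℝ (Fin m)} (hp : p ∈ P) (hl : ∀ y ∈ P, l y ≤ l p) :
    IsFace P {x ∈ P | l x = l p} := by
  refine ⟨fun _ => ⟨l, ?_⟩, p, hp, rfl⟩
  ext x
  exact ⟨fun hx => ⟨hx.1, fun y hy => hx.2 ▸ hl y hy⟩,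
    fun hx => ⟨hx.1, le_antisymm (hl x hx.1) (hx.2 p hp)⟩⟩

theorem map_eq_zero_of_mem_vectorSpan (l : StrongDual ℝ (EuclideanSpace ℝ (Fin m)))
    {p : EuclideanSpace ℝ (Fin m)} (h : ∀ x ∈ F, l x = l p) {u : EuclideanSpace ℝ (Fin m)}
    (hu : u ∈ vectorSpan ℝ F) : l u = 0 := by
  have : vectorSpan ℝ F ≤ LinearMap.ker l.toLinearMap := by
    refine Submodule.span_le.2 ?_
    rintro _ ⟨a, ha, b, hb, rfl⟩
    simp [h a ha, h b hb]
  exact this hu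

theorem dim_eq_finrank_vectorSpan : dim F = Module.finrank ℝ (vectorSpan ℝ F) := by
  rw [dim, direction_affineSpan]

/-- If the two direction spaces agreed, the functional cutting out `F` would be constant on `G`,
forcing `G ⊆ F`. -/
theorem dim_lt_dim (hF : IsFace P F) (hG : IsFace P G) (h : F < G) : dim F < dim G := by
  rw [dim_eq_finrank_vectorSpan, dim_eq_finrank_vectorSpan]
  refine Submodule.finrank_lt_finrank_of_lt (lt_of_le_of_ne (vectorSpan_mono ℝ h.le) fun he => ?_)
  obtain ⟨l, p, hp, -, hFl⟩ := hF.exists_functional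
  refine h.not_ge fun g hg => (hFl g).2 ⟨hG.subset hg, ?_⟩
  have := map_eq_zero_of_mem_vectorSpan l (fun x hx => ((hFl x).1 hx).2)
    (he ▸ vsub_mem_vectorSpan ℝ hg (h.le hp))
  simpa [sub_eq_zero] using this

theorem functional_le_of_convexHull {s : Set (EuclideanSpace ℝ (Fin m))}
    (l : StrongDual ℝ (EuclideanSpace ℝ (Fin m))) {c : ℝ} (h : ∀ v ∈ s, l v ≤ c)
    {x : EuclideanSpace ℝ (Fin m)} (hx : x ∈ convexHull ℝ s) : l x ≤ c :=
  convexHull_min (t := {x | l x ≤ c}) h (convex_halfSpace_le l.toLinearMap.isLinear c) hx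

/-- A functional that is maximal at `p` among the vertices where `l` is maximal becomes maximal at
`p` on the whole polytope after adding a large multiple of `l`. -/
theorem exists_smul_add_le {s : Finset (EuclideanSpace ℝ (Fin m))}
    (l g : StrongDual ℝ (EuclideanSpace ℝ (Fin m))) {p : EuclideanSpace ℝ (Fin m)}
    (hl : ∀ v ∈ s, l v ≤ l p) (hg : ∀ v ∈ s, l v = l p → g v ≤ g p) :
    ∃ K : ℝ, ∀ x ∈ convexHull ℝ (s : Set (EuclideanSpace ℝ (Fin m))),
      K * l x + g x ≤ K * l p + g p := by
  have h : ∀ᶠ K : ℝ in Filter.atTop, ∀ v ∈ s, K * l v + g v ≤ K * l p + g p := by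
    rw [Filter.eventually_all_finset]
    intro v hv
    rcases (hl v hv).eq_or_lt with h | h
    · exact Filter.Eventually.of_forall fun K => by rw [h]; linarith [hg v hv h]
    · filter_upwards [Filter.eventually_ge_atTop ((g v - g p) / (l p - l v))] with K hK
      rw [div_le_iff₀ (by linarith)] at hK
      linarith
  obtain ⟨K, hK⟩ := h.exists
  refine ⟨K, fun x hx => ?_⟩
  have := functional_le_of_convexHull (K • l + g) (c := K * l p + g p)
    (by simpa using hK) hx
  simpa using this

/-- The maximisers on a face of a functional form a face of the polytope. -/
theorem IsFace.isFace_maximisers (hP : IsPolytope P) (hG : IsFace P G)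
    (g : StrongDual ℝ (EuclideanSpace ℝ (Fin m))) {p : EuclideanSpace ℝ (Fin m)} (hp : p ∈ G)
    (hg : ∀ y ∈ G, g y ≤ g p) : IsFace P {x ∈ G | g x = g p} := by
  obtain ⟨s, rfl⟩ := hP
  obtain ⟨l, q, hq, hlq, hGl⟩ := hG.exists_functional
  have hlp : l p = l q := ((hGl p).1 hp).2
  obtain ⟨K, hK⟩ := exists_smul_add_le (s := s) l g (p := p)
    (fun v hv => hlp ▸ hlq v (subset_convexHull ℝ _ hv))
    (fun v hv h => hg v ((hGl v).2 ⟨subset_convexHull ℝ _ hv, h.trans hlp⟩))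
  -- `K` already makes `K • l + g` maximal at `p`; the extra copy of `l` forces every maximiser into
  -- `G`.
  have key := isFace_of_functional ((K + 1) • l + g) (hG.subset hp) (fun y hy => by
    have h1 := hK y hy
    have h2 := hlq y hy
    simp only [add_apply, smul_apply, smul_eq_mul]
    linarith)
  convert key using 1
  ext x
  simp only [Set.mem_ofPred_eq, hGl, add_apply, smul_apply,
    smul_eq_mul, and_assoc]
  refine and_congr_right fun hx => ⟨fun h => by rw [h.1, h.2, hlp], fun h => ?_⟩
  have h1 := hK x hx
  have h2 := hlq x hx
  have h3 : l x = l q := by linarith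
  exact ⟨h3, by rw [h3, hlp] at h; linarith⟩

theorem IsFace.functional_le {s : Finset (EuclideanSpace ℝ (Fin m))}
    (hG : IsFace (convexHull ℝ (s : Set (EuclideanSpace ℝ (Fin m)))) G)
    (g : StrongDual ℝ (EuclideanSpace ℝ (Fin m))) {p : EuclideanSpace ℝ (Fin m)} (hp : p ∈ G)
    (hg : ∀ v ∈ s, v ∈ G → g v ≤ g p) {x : EuclideanSpace ℝ (Fin m)} (hx : x ∈ G) :
    g x ≤ g p := by
  obtain ⟨l, q, hq, hlq, hGl⟩ := hG.exists_functional
  have hlp : l p = l q := ((hGl p).1 hp).2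
  obtain ⟨K, hK⟩ := exists_smul_add_le (s := s) l g (p := p)
    (fun v hv => hlp ▸ hlq v (subset_convexHull ℝ _ hv))
    (fun v hv h => hg v hv ((hGl v).2 ⟨subset_convexHull ℝ _ hv, h.trans hlp⟩))
  have h1 := hK x (hG.subset hx)
  have h2 : l x = l q := ((hGl x).1 hx).2
  rw [h2, hlp] at h1
  linarith

/-- The directions of `F` together with `q - p` span at most `dim F + 1` dimensions, so some
direction of `G` escapes them and is detected by a functional killing them. This is the direction in
which `exists_isFace_between` tilts a supporting hyperplane. -/
theorem exists_functional_of_dim {p q : EuclideanSpace ℝ (Fin m)} (hp : p ∈ F)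
    (hdim : dim F + 2 ≤ dim G) :
    ∃ h : StrongDual ℝ (EuclideanSpace ℝ (Fin m)), (∀ x ∈ F, h x = h p) ∧ h q = h p ∧
      ∃ v ∈ G, h p < h v := by
  rw [dim_eq_finrank_vectorSpan, dim_eq_finrank_vectorSpan] at hdim
  have hW : ¬ vectorSpan ℝ G ≤ vectorSpan ℝ F ⊔ Submodule.span ℝ {q - p} := by
    intro hle
    have h1 := Submodule.finrank_mono hle
    have h2 := Submodule.finrank_add_le_finrank_add_finrank (vectorSpan ℝ F)
      (Submodule.span ℝ {q - p})
    have h3 := finrank_span_le_card (R := ℝ) ({q - p} : Set (EuclideanSpace ℝ (Fin m)))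
    simp at h3
    omega
  obtain ⟨u, hu, huW⟩ := Set.not_subset.1 hW
  obtain ⟨f, hfu, hfW⟩ := Submodule.exists_le_ker_of_notMem huW
  have key : ∃ h : StrongDual ℝ (EuclideanSpace ℝ (Fin m)), (∀ x ∈ F, h x = h p) ∧ h q = h p ∧
      h u ≠ 0 := by
    refine ⟨LinearMap.toContinuousLinearMap f, fun x hx => ?_, ?_, hfu⟩
    · have := hfW (Submodule.mem_sup_left (vsub_mem_vectorSpan ℝ hx hp))
      simpa [sub_eq_zero] using this
    · have := hfW (Submodule.mem_sup_right (Submodule.mem_span_singleton_self (q - p)))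
      simpa [sub_eq_zero] using this
  obtain ⟨h, h1, h2, h3⟩ := key
  have : ∃ v ∈ G, h v ≠ h p := by
    by_contra! hc
    exact h3 (map_eq_zero_of_mem_vectorSpan h hc hu)
  obtain ⟨v, hv, hne⟩ := this
  rcases hne.lt_or_gt with hlt | hlt
  · exact ⟨-h, by simpa using h1, by simpa using h2, v, hv, by simpa using hlt⟩
  · exact ⟨h, h1, h2, v, hv, hlt⟩

/-- Between two faces whose dimensions differ by at least two there is another face. -/
theorem exists_isFace_between (hP : IsPolytope P) (hF : IsFace P F) (hG : IsFace P G)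
    (hFG : F < G) (hdim : dim F + 2 ≤ dim G) : ∃ H, IsFace P H ∧ F < H ∧ H < G := by
  classical
  obtain ⟨l, p, hp, hl, hFl⟩ := hF.exists_functional
  obtain ⟨q, hqG, hqF⟩ := Set.exists_of_ssubset hFG
  obtain ⟨h, hhF, hhq, v₀, hv₀G, hv₀⟩ := exists_functional_of_dim (q := q) hp hdim
  obtain ⟨s, rfl⟩ := id hP
  set T := s.filter (fun v => v ∈ G ∧ h p < h v) with hT
  have hTne : T.Nonempty := by
    by_contra hc
    rw [Finset.not_nonempty_iff_eq_empty] at hc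
    refine hv₀.not_ge (hG.functional_le h (hFG.le hp) (fun v hv hvG => ?_) hv₀G)
    by_contra hlt
    exact Finset.notMem_empty v (hc ▸ Finset.mem_filter.2 ⟨hv, hvG, not_le.1 hlt⟩)
  obtain ⟨v, hv, hmin⟩ := T.exists_min_image (fun v => (l p - l v) / (h v - h p)) hTne
  obtain ⟨hvs, hvG, hvh⟩ := Finset.mem_filter.1 hv
  -- Tilting `l` to `l + t • h` fixes its values relative to `p` on `F` and at `q`. The least ratio
  -- is the moment a vertex `v` of `G` outside `F` first becomes a maximiser: `v` makes the new face
  -- larger than `F`, and `q` stays strictly below, so it is smaller than `G`.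
  set t := (l p - l v) / (h v - h p) with ht
  have ht0 : 0 ≤ t := div_nonneg (by linarith [hl v (hG.subset hvG)]) (by linarith)
  have htv : t * (h v - h p) = l p - l v := div_mul_cancel₀ _ (by linarith)
  have hmax : ∀ x ∈ G, (l + t • h) x ≤ (l + t • h) p := by
    intro x hx
    refine hG.functional_le _ (hFG.le hp) (fun w hw hwG => ?_) hx
    simp only [add_apply, smul_apply, smul_eq_mul]
    rcases le_or_gt (h w) (h p) with hle | hlt
    · have := mul_le_mul_of_nonneg_left hle ht0
      linarith [hl w (hG.subset hwG)]
    · have := hmin w (Finset.mem_filter.2 ⟨hw, hwG, hlt⟩)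
      rw [le_div_iff₀ (by linarith)] at this
      linarith
  refine ⟨_, hG.isFace_maximisers hP (l + t • h) (hFG.le hp) hmax, ?_, ?_⟩
  · refine Set.ssubset_iff_exists.2 ⟨fun x hx => ⟨hFG.le hx, ?_⟩, v, ⟨hvG, ?_⟩, fun hvF => ?_⟩
    · simp [hhF x hx, ((hFl x).1 hx).2]
    · simp only [add_apply, smul_apply, smul_eq_mul]
      linarith
    · exact hvh.ne' (hhF v hvF)
  · refine Set.ssubset_iff_exists.2 ⟨fun x hx => hx.1, q, hqG, fun hq => hqF ?_⟩
    have := hq.2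
    simp only [add_apply, smul_apply, smul_eq_mul,
      hhq] at this
    exact (hFl q).2 ⟨hG.subset hqG, by linarith⟩

theorem IsPolytope.isCompact (hP : IsPolytope P) : IsCompact P := by
  obtain ⟨s, rfl⟩ := hP
  exact s.finite_toSet.isCompact_convexHull ℝ

/-- A face of positive dimension has a proper subface. -/
theorem exists_isFace_lt (hP : IsPolytope P) (hG : IsFace P G) (hdim : dim G ≠ 0) :
    ∃ H, IsFace P H ∧ H < G := by
  have hnt : G.Nontrivial := by
    by_contra hc
    rw [Set.not_nontrivial_iff] at hc
    refine hdim ?_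
    rw [dim_eq_finrank_vectorSpan, vectorSpan_of_subsingleton ℝ hc, finrank_bot]
  obtain ⟨a, ha, b, hb, hab⟩ := hnt
  set g : StrongDual ℝ (EuclideanSpace ℝ (Fin m)) := innerSL ℝ (b - a) with hg
  have hlt : g a < g b := by
    have : 0 < g (b - a) := by
      exact real_inner_self_pos.2 (sub_ne_zero.2 hab.symm)
    rw [map_sub] at this
    linarith
  obtain ⟨p, hp, hmax⟩ := (hG.1.isCompact hP.isCompact).exists_isMaxOn hG.2 g.continuous.continuousOn
  refine ⟨_, hG.isFace_maximisers hP g hp hmax, Set.ssubset_iff_exists.2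
    ⟨fun x hx => hx.1, a, ha, fun h => ?_⟩⟩
  have h1 := hmax hb
  simp only [Set.mem_ofPred_eq] at h1
  linarith [h.2]

/-- The poset of nonempty faces. -/
abbrev Face (P : Set (EuclideanSpace ℝ (Fin m))) : Type :=
  {F : Set (EuclideanSpace ℝ (Fin m)) // IsFace P F}

theorem Face.dim_lt_dim {F G : Face P} (h : F < G) : dim F.1 < dim G.1 :=
  ExtNest.dim_lt_dim F.2 G.2 h

theorem Face.dim_eq_of_covBy (hP : IsPolytope P) {F G : Face P} (h : F ⋖ G) :
    dim G.1 = dim F.1 + 1 := by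
  have h1 := Face.dim_lt_dim h.lt
  by_contra hne
  obtain ⟨H, hH, hFH, hHG⟩ := exists_isFace_between hP F.2 G.2 h.lt (by omega)
  exact h.2 (c := ⟨H, hH⟩) hFH hHG

theorem Face.exists_covBy (hP : IsPolytope P) {G : Face P} (hG : dim G.1 ≠ 0) :
    ∃ F : Face P, F ⋖ G := by
  obtain ⟨H, hH, hHG⟩ := exists_isFace_lt hP G.2 hG
  have hne : {k | ∃ F : Face P, F < G ∧ dim G.1 - dim F.1 = k}.Nonempty :=
    ⟨_, ⟨H, hH⟩, hHG, rfl⟩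
  -- A proper subface of largest dimension is covered by `G`.
  obtain ⟨F, hF, hk⟩ := WellFounded.min_mem wellFounded_lt _ hne
  refine ⟨F, hF, fun K hFK hKG => ?_⟩
  have h1 := Face.dim_lt_dim hFK
  have h2 := Face.dim_lt_dim hKG
  have := WellFounded.not_lt_min wellFounded_lt
    {k | ∃ F : Face P, F < G ∧ dim G.1 - dim F.1 = k} ⟨K, hKG, rfl⟩
  rw [← hk] at this
  omega

/-- Combinatorial equivalences of polytopes preserve the dimensions of faces. -/
theorem Face.dim_orderIso {m' : ℕ} {Q : Set (EuclideanSpace ℝ (Fin m'))} (hP : IsPolytope P)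
    (hQ : IsPolytope Q) (e : Face P ≃o Face Q) (F : Face P) : dim (e F).1 = dim F.1 := by
  generalize hk : dim F.1 = k
  induction k generalizing F with
  | zero =>
    by_contra hne
    obtain ⟨G, hG⟩ := Face.exists_covBy hQ hne
    have := Face.dim_lt_dim (e.symm_apply_lt.2 hG.lt)
    omega
  | succ k ih =>
    obtain ⟨G, hG⟩ := Face.exists_covBy hP (G := F) (by omega)
    have h1 := Face.dim_eq_of_covBy hP hG
    rw [Face.dim_eq_of_covBy hQ ((apply_covBy_apply_iff e).2 hG), ih G (by omega)]

end Faces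

/-! ### Face posets of polyhedra through active sets. -/

section Polyhedra
variable {m : ℕ} {ι : Type*} {a : ι → StrongDual ℝ (EuclideanSpace ℝ (Fin m))}
  {c : ι → ℝ} {x y : EuclideanSpace ℝ (Fin m)}

/-- The polyhedron of solutions of finitely many linear inequalities. -/
def polyhedron (a : ι → StrongDual ℝ (EuclideanSpace ℝ (Fin m))) (c : ι → ℝ) :
    Set (EuclideanSpace ℝ (Fin m)) :=
  {x | ∀ v, a v x ≤ c v}

theorem convex_polyhedron : Convex ℝ (polyhedron a c) := by
  intro x hx y hy s t hs ht hst v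
  have h1 := mul_le_mul_of_nonneg_left (hx v) hs
  have h2 := mul_le_mul_of_nonneg_left (hy v) ht
  have h3 : s * c v + t * c v = c v := by rw [← add_mul, hst, one_mul]
  simp only [map_add, map_smul, smul_eq_mul]
  linarith

theorem isClosed_polyhedron : IsClosed (polyhedron a c) := by
  have : polyhedron a c = ⋂ v, {x | a v x ≤ c v} := by
    ext; simp [polyhedron]
  rw [this]
  exact isClosed_iInter fun v => isClosed_le (a v).continuous continuous_const

variable [Fintype ι]

open Classical in
/-- The inequalities that are equalities at `x`. -/
noncomputable def activeSet (a : ι → StrongDual ℝ (EuclideanSpace ℝ (Fin m))) (c : ι → ℝ)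
    (x : EuclideanSpace ℝ (Fin m)) : Finset ι :=
  Finset.univ.filter (fun v => a v x = c v)

theorem mem_activeSet {v : ι} : v ∈ activeSet a c x ↔ a v x = c v := by
  simp [activeSet]

/-- One can move a little beyond `x`, away from `y`, if every equality at `x` also holds at `y`. -/
theorem exists_add_smul_mem_polyhedron (hx : x ∈ polyhedron a c)
    (h : activeSet a c x ⊆ activeSet a c y) :
    ∃ ε : ℝ, 0 < ε ∧ x + ε • (x - y) ∈ polyhedron a c := by
  have key : ∀ᶠ ε : ℝ in nhdsWithin 0 (Set.Ioi 0), ∀ v, a v (x + ε • (x - y)) ≤ c v := by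
    rw [Filter.eventually_all]
    intro v
    rcases (hx v).eq_or_lt with hv | hv
    · have := mem_activeSet.1 (h (mem_activeSet.2 hv))
      refine Filter.Eventually.of_forall fun ε => ?_
      simp [hv, this]
    · have hc : Continuous fun ε : ℝ => a v (x + ε • (x - y)) := by fun_prop
      have := (hc.tendsto 0).eventually_lt_const (u := c v) (by simpa using hv)
      exact (this.filter_mono nhdsWithin_le_nhds).mono fun ε => le_of_lt
  obtain ⟨ε, hε, h0⟩ := (key.and self_mem_nhdsWithin).exists
  exact ⟨ε, h0, hε⟩

theorem eq_of_mem_extremePoints_polyhedron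
    (hx : x ∈ (polyhedron a c).extremePoints ℝ) (hy : y ∈ polyhedron a c)
    (h : activeSet a c x ⊆ activeSet a c y) : y = x := by
  obtain ⟨ε, hε, hz⟩ := exists_add_smul_mem_polyhedron hx.1 h
  -- `x` lies strictly between `y` and `x + ε • (x - y)`, with these weights.
  refine hx.2 hy hz ⟨ε / (1 + ε), 1 / (1 + ε), by positivity, by positivity, by field_simp; ring, ?_⟩
  have h1 : (1 + ε) ≠ 0 := by positivity
  rw [smul_add, smul_smul, smul_sub]
  have h2 : (1 / (1 + ε)) • x = x - (ε / (1 + ε)) • x := by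
    rw [eq_sub_iff_add_eq, ← add_smul]
    have : 1 / (1 + ε) + ε / (1 + ε) = 1 := by field_simp
    rw [this, one_smul]
  have h3 : 1 / (1 + ε) * ε = ε / (1 + ε) := by ring
  rw [h2, h3]
  abel

/-- An extreme point is determined by its active set, so there are finitely many; Krein–Milman then
applies. -/
theorem isPolytope_polyhedron (hb : Bornology.IsBounded (polyhedron a c)) :
    IsPolytope (polyhedron a c) := by
  have hfin : ((polyhedron a c).extremePoints ℝ).Finite := by
    refine Set.Finite.of_finite_image (f := activeSet a c) (Set.toFinite _) ?_
    intro x hx y hy hxy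
    exact (eq_of_mem_extremePoints_polyhedron hx hy.1 hxy.le).symm
  refine ⟨hfin.toFinset, ?_⟩
  have := closure_convexHull_extremePoints (Metric.isCompact_of_isClosed_isBounded
    (isClosed_polyhedron (a := a) (c := c)) hb) convex_polyhedron
  rw [(hfin.isClosed_convexHull ℝ).closure_eq] at this
  rw [hfin.coe_toFinset, this]

/-- The sum of the functionals active at `x` is maximal exactly where all of these inequalities are
tight. -/
theorem isFace_polyhedron (hx : x ∈ polyhedron a c) :
    IsFace (polyhedron a c) {y ∈ polyhedron a c | activeSet a c x ⊆ activeSet a c y} := by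
  have hsum : ∀ y, (∑ v ∈ activeSet a c x, a v) y = ∑ v ∈ activeSet a c x, a v y :=
    fun y => by simp
  have hx' : ∀ v ∈ activeSet a c x, a v x = c v := fun v => mem_activeSet.1
  have key := isFace_of_functional (∑ v ∈ activeSet a c x, a v) hx (fun y hy => by
    rw [hsum, hsum, Finset.sum_congr rfl hx']
    exact Finset.sum_le_sum fun v _ => hy v)
  convert key using 1
  ext y
  refine and_congr_right fun hy => ?_
  rw [hsum, hsum, Finset.sum_congr rfl hx', Finset.sum_eq_sum_iff_of_le fun v _ => hy v]
  exact forall₂_congr fun v _ => mem_activeSet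

theorem exists_eq_of_isFace_polyhedron {F : Set (EuclideanSpace ℝ (Fin m))}
    (hF : IsFace (polyhedron a c) F) :
    ∃ x ∈ polyhedron a c, F = {y ∈ polyhedron a c | activeSet a c x ⊆ activeSet a c y} := by
  classical
  obtain ⟨l, p, hp, hl, hFl⟩ := hF.exists_functional
  -- A point of `F` with fewest active inequalities plays the role of a relative interior point: the
  -- midpoint with any other point of `F` has no larger active set, so the minimal one is contained
  -- in every other.
  obtain ⟨N, hN, hmin⟩ := Set.exists_min_image (activeSet a c '' F) Finset.card
    (Set.toFinite _) ⟨_, p, hp, rfl⟩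
  obtain ⟨x, hx, rfl⟩ := hN
  have hxl := (hFl x).1 hx
  refine ⟨x, hxl.1, Set.ext fun y => ⟨fun hy => ⟨hF.subset hy, ?_⟩, fun hy => (hFl y).2 ⟨hy.1, ?_⟩⟩⟩
  · have hyl := (hFl y).1 hy
    set z := (1 / 2 : ℝ) • x + (1 / 2 : ℝ) • y with hz
    have hzF : z ∈ F := (hFl z).2
      ⟨convex_polyhedron hxl.1 hyl.1 (by norm_num) (by norm_num) (by norm_num), by
        simp only [hz, map_add, map_smul, smul_eq_mul, hxl.2, hyl.2]; ring⟩
    have hza : activeSet a c z ⊆ activeSet a c x ∩ activeSet a c y := by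
      intro v hv
      have h0 := mem_activeSet.1 hv
      simp only [hz, map_add, map_smul, smul_eq_mul] at h0
      have h1 := hxl.1 v
      have h2 := hyl.1 v
      exact Finset.mem_inter.2 ⟨mem_activeSet.2 (by linarith), mem_activeSet.2 (by linarith)⟩
    have h1 := hmin _ ⟨z, hzF, rfl⟩
    have h2 := Finset.eq_of_subset_of_card_le (hza.trans Finset.inter_subset_left) h1
    rw [← h2]
    exact hza.trans Finset.inter_subset_right
  -- If `l` were smaller at `y` than at `x`, moving beyond `x` away from `y` would exceed the
  -- maximum.
  · obtain ⟨ε, hε, hz⟩ := exists_add_smul_mem_polyhedron hxl.1 hy.2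
    have h1 := hl _ hz
    have h2 := hl y hy.1
    simp only [map_add, map_smul, map_sub, smul_eq_mul, hxl.2] at h1
    have h3 : ε * (l p - l y) ≤ 0 := by linarith
    have h4 := nonpos_of_mul_nonpos_right h3 hε
    linarith

/-- The face poset of a polyhedron is dual to the poset of its active sets. -/
noncomputable def polyhedronFaceIso {p : Finset ι → Prop}
    (hp : ∀ N, p N ↔ ∃ x ∈ polyhedron a c, activeSet a c x = N) :
    Face (polyhedron a c) ≃o {N // p N}ᵒᵈ := by
  refine (RelIso.ofSurjective (OrderEmbedding.ofMapLEIff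
    (fun N : {N // p N}ᵒᵈ => (⟨{y ∈ polyhedron a c | (OrderDual.ofDual N).1 ⊆ activeSet a c y}, ?_⟩ :
      Face (polyhedron a c))) ?_) ?_).symm
  · obtain ⟨x, hx, hxN⟩ := (hp _).1 (OrderDual.ofDual N).2
    rw [← hxN]
    exact isFace_polyhedron hx
  · intro N N'
    refine ⟨fun h => ?_, fun h y hy => ⟨hy.1, Finset.Subset.trans h hy.2⟩⟩
    obtain ⟨x, hx, hxN⟩ := (hp _).1 (OrderDual.ofDual N).2
    have : x ∈ {y ∈ polyhedron a c | (OrderDual.ofDual N').1 ⊆ activeSet a c y} :=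
      h ⟨hx, hxN.ge⟩
    exact this.2.trans hxN.le
  · rintro ⟨F, hF⟩
    obtain ⟨x, hx, rfl⟩ := exists_eq_of_isFace_polyhedron hF
    exact ⟨OrderDual.toDual ⟨activeSet a c x, (hp _).2 ⟨x, hx, rfl⟩⟩, rfl⟩

theorem dim_polyhedron (hx : x ∈ polyhedron a c) (h : activeSet a c x = ∅) :
    dim (polyhedron a c) = m := by
  have hopen : IsOpen {y | ∀ v, a v y < c v} := by
    have : {y | ∀ v, a v y < c v} = ⋂ v, {y | a v y < c v} := by ext; simp
    rw [this]
    exact isOpen_iInter_of_finite fun v => isOpen_lt (a v).continuous continuous_const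
  have hint : (interior (polyhedron a c)).Nonempty := by
    refine ⟨x, interior_maximal (fun y hy v => (hy v).le) hopen fun v => ?_⟩
    refine lt_of_le_of_ne (hx v) fun hv => ?_
    have := mem_activeSet.2 hv
    simp [h] at this
  have hs : affineSpan ℝ (polyhedron a c) = ⊤ := by
    rw [eq_top_iff, ← isOpen_interior.affineSpan_eq_top hint]
    exact affineSpan_mono ℝ interior_subset
  rw [dim, hs, AffineSubspace.direction_top, finrank_top, finrank_euclideanSpace_fin]

end Polyhedra

/-! ### Nested collections. -/

section Nested
variable {n : ℕ} {B : Finset (Finset (Fin n))} {N S : Finset (Finset (Fin n))}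
  {I J K L U : Finset (Fin n)}

/-- Nested collections: the extended nested collections without design vertices. -/
structure IsNested (B N : Finset (Finset (Fin n))) : Prop where
  mem : ∀ I ∈ N, I ∈ B
  disjoint_or_nested : ∀ I ∈ N, ∀ J ∈ N, I ⊆ J ∨ J ⊆ I ∨ Disjoint I J
  union_notMem : ∀ T ⊆ N, 2 ≤ T.card →
    (T : Set (Finset (Fin n))).PairwiseDisjoint id → T.sup id ∉ B

theorem isExtendedNested_iff {N : Finset (Finset (Fin n) ⊕ Fin n)} :
    IsExtendedNested B N ↔ IsNested B N.toLeft ∧ Disjoint N.toRight (N.toLeft.sup id) := by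
  constructor
  · refine fun h => ⟨⟨fun I hI => h.mem I (Finset.mem_toLeft.1 hI),
      fun I hI J hJ => h.disjoint_or_nested I J (Finset.mem_toLeft.1 hI) (Finset.mem_toLeft.1 hJ),
      fun T hT => h.union_notMem T fun I hI => Finset.mem_toLeft.1 (hT hI)⟩, ?_⟩
    rw [Finset.disjoint_left]
    intro i hi hs
    obtain ⟨I, hI, hiI⟩ := Finset.mem_sup.1 hs
    exact h.design I i (Finset.mem_toLeft.1 hI) (Finset.mem_toRight.1 hi) hiI
  · rintro ⟨h, hd⟩
    refine ⟨fun I hI => h.mem I (Finset.mem_toLeft.2 hI),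
      fun I J hI hJ => h.disjoint_or_nested I (Finset.mem_toLeft.2 hI) J (Finset.mem_toLeft.2 hJ),
      fun T hT => h.union_notMem T fun I hI => Finset.mem_toLeft.2 (hT I hI), ?_⟩
    intro I i hI hi hiI
    exact Finset.disjoint_left.1 hd (Finset.mem_toRight.2 hi)
      (Finset.mem_sup.2 ⟨I, Finset.mem_toLeft.2 hI, hiI⟩)

theorem IsNested.mono (h : IsNested B N) (hS : S ⊆ N) : IsNested B S :=
  ⟨fun I hI => h.mem I (hS hI), fun I hI J hJ => h.disjoint_or_nested I (hS hI) J (hS hJ),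
    fun T hT => h.union_notMem T (hT.trans hS)⟩

theorem IsExtendedNested.mono {N N' : Finset (Finset (Fin n) ⊕ Fin n)} (h : IsExtendedNested B N)
    (hN : N' ⊆ N) : IsExtendedNested B N' :=
  ⟨fun I hI => h.mem I (hN hI), fun I J hI hJ => h.disjoint_or_nested I J (hN hI) (hN hJ),
    fun T hT => h.union_notMem T fun I hI => hN (hT I hI),
    fun I i hI hi => h.design I i (hN hI) (hN hi)⟩

theorem isExtendedNested_empty : IsExtendedNested B ∅ := by
  refine ⟨by simp, by simp, fun T hT h2 => ?_, by simp⟩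
  have : T = ∅ := Finset.eq_empty_of_forall_notMem fun I hI => by simpa using hT I hI
  simp [this] at h2

theorem IsBuildingSet.union_sup_mem (hB : IsBuildingSet B) (hK : K ∈ B)
    (hS : ∀ I ∈ S, I ∈ B ∧ (I ∩ K).Nonempty) : K ∪ S.sup id ∈ B := by
  induction S using Finset.induction_on with
  | empty => simpa using hK
  | insert I S _ ih =>
    have h1 := hS I (Finset.mem_insert_self _ _)
    have h2 := ih fun J hJ => hS J (Finset.mem_insert_of_mem hJ)
    have h3 := hB.union I h1.1 _ h2 (h1.2.mono
      (Finset.inter_subset_inter_left Finset.subset_union_left))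
    have h4 : K ∪ (insert I S).sup id = I ∪ (K ∪ S.sup id) := by
      rw [Finset.sup_insert, id, Finset.sup_eq_union, Finset.union_left_comm]
    rwa [h4]

/-- A member of the building set covered by members of a nested collection is contained in one of
them. -/
theorem IsNested.exists_subset (hB : IsBuildingSet B) (hN : IsNested B N) (hK : K ∈ B)
    (hKN : K ⊆ N.sup id) : ∃ J ∈ N, K ⊆ J := by
  -- The maximal members meeting `K` are pairwise disjoint and cover `K`, and their union lies in
  -- `B` because each meets `K`. Nestedness leaves room for only one.
  set T := (N.filter fun J => (J ∩ K).Nonempty).filter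
    (fun J => ∀ J' ∈ N, J ⊆ J' → J' = J) with hT
  have hTN : T ⊆ N := (Finset.filter_subset _ _).trans (Finset.filter_subset _ _)
  have hdisj : (T : Set (Finset (Fin n))).PairwiseDisjoint id := by
    intro I hI J hJ hne
    simp only [hT, Finset.coe_filter, Finset.mem_filter, Set.mem_ofPred_eq] at hI hJ
    rcases hN.disjoint_or_nested I hI.1.1 J hJ.1.1 with h | h | h
    · exact absurd (hI.2 J hJ.1.1 h).symm hne
    · exact absurd (hJ.2 I hI.1.1 h) hne
    · exact h
  have hcov : K ⊆ T.sup id := by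
    intro i hi
    obtain ⟨I, hI, hiI⟩ := Finset.mem_sup.1 (hKN hi)
    obtain ⟨J, hIJ, hJ⟩ := N.exists_le_maximal hI
    refine Finset.mem_sup.2 ⟨J, ?_, hIJ hiI⟩
    simp only [hT, Finset.mem_filter]
    exact ⟨⟨hJ.1, i, Finset.mem_inter.2 ⟨hIJ hiI, hi⟩⟩, fun J' hJ' h => (hJ.eq_of_ge hJ' h)⟩
  have hmem := hB.union_sup_mem hK (S := T) fun I hI =>
    ⟨hN.mem I (hTN hI), (Finset.mem_filter.1 (Finset.mem_filter.1 hI).1).2⟩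
  rw [Finset.union_eq_right.2 hcov] at hmem
  have hcard : T.card < 2 := by
    by_contra h
    exact hN.union_notMem T hTN (not_lt.1 h) hdisj hmem
  have hne : T.Nonempty := by
    rw [Finset.nonempty_iff_ne_empty]
    intro h
    rw [h, Finset.sup_empty] at hmem
    exact Finset.not_nonempty_empty (hB.nonempty _ hmem)
  obtain ⟨J, hJ⟩ := Finset.card_eq_one.1 (show T.card = 1 by have := hne.card_pos; omega)
  refine ⟨J, hTN (by simp [hJ]), by simpa [hJ] using hcov⟩

/-- A maximal member of a nested collection is not covered by the other ones. -/
theorem IsNested.sdiff_nonempty (hB : IsBuildingSet B) (hN : IsNested B N) (hK : K ∈ N)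
    (hmax : ∀ J ∈ N, K ⊆ J → J = K) : (K \ (N.erase K).sup id).Nonempty := by
  rw [Finset.sdiff_nonempty]
  intro h
  obtain ⟨J, hJ, hKJ⟩ := (hN.mono (N.erase_subset K)).exists_subset hB (hN.mem K hK) h
  exact (Finset.mem_erase.1 hJ).1 (hmax J (Finset.mem_erase.1 hJ).2 hKJ)

theorem exists_maximal_mem (hne : N.Nonempty) : ∃ K ∈ N, ∀ J ∈ N, K ⊆ J → J = K := by
  obtain ⟨K, hK⟩ := N.exists_maximal hne
  exact ⟨K, hK.1, fun J hJ h => hK.eq_of_ge hJ h⟩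

theorem sup_eq_union_sup_erase (hK : K ∈ N) : N.sup id = K ∪ (N.erase K).sup id := by
  conv_lhs => rw [← Finset.insert_erase hK, Finset.sup_insert]
  rfl

/-- Peeling off a maximal member loses at least one point of the union. The bound also keeps the
natural-number exponents `U.card - N.card` from being truncated. -/
theorem IsNested.card_le (hB : IsBuildingSet B) (hN : IsNested B N) :
    N.card ≤ (N.sup id).card := by
  induction h : N.card generalizing N with
  | zero => simp
  | succ k ih =>
    obtain ⟨K, hK, hmax⟩ := exists_maximal_mem (Finset.card_pos.1 (by omega : 0 < N.card))
    obtain ⟨i, hi⟩ := hN.sdiff_nonempty hB hK hmax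
    rw [Finset.mem_sdiff] at hi
    have h1 := ih (hN.mono (N.erase_subset K)) (by rw [Finset.card_erase_of_mem hK, h]; rfl)
    have h2 : (N.erase K).sup id ⊂ N.sup id := Finset.ssubset_iff_subset_ne.2
      ⟨Finset.sup_mono (N.erase_subset K), fun he => hi.2 (he ▸ Finset.mem_sup.2 ⟨K, hK, hi.1⟩)⟩
    have := Finset.card_lt_card h2
    omega

end Nested

/-! ### Numerical bounds and coordinates for a given nested collection. -/

section Realization
variable {n : ℕ} {B : Finset (Finset (Fin n))} {N S : Finset (Finset (Fin n))}
  {I J K L U : Finset (Fin n)}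

/-- The lower bound `(n + 2)ᵏ - 1` imposed on the sum of the coordinates in a `k`-element member of
the building set. -/
def bound (n k : ℕ) : ℝ := (n + 2 : ℝ) ^ k - 1

theorem bound_zero : bound n 0 = 0 := by simp [bound]

theorem bound_add_le (i j : ℕ) : bound n i + bound n j ≤ bound n (i + j) := by
  have h1 : (1 : ℝ) ≤ (n + 2 : ℝ) ^ i := one_le_pow₀ (by linarith [Nat.cast_nonneg (α := ℝ) n])
  have h2 : (1 : ℝ) ≤ (n + 2 : ℝ) ^ j := one_le_pow₀ (by linarith [Nat.cast_nonneg (α := ℝ) n])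
  simp only [bound, pow_add]
  nlinarith [mul_nonneg (sub_nonneg.2 h1) (sub_nonneg.2 h2)]

theorem bound_mono {i j : ℕ} (h : i ≤ j) : bound n i ≤ bound n j := by
  have := pow_le_pow_right₀ (show (1 : ℝ) ≤ n + 2 by linarith [Nat.cast_nonneg (α := ℝ) n]) h
  simp only [bound]
  linarith

theorem bound_pos {i : ℕ} (h : 0 < i) : 0 < bound n i := by
  have := one_lt_pow₀ (show (1 : ℝ) < n + 2 by linarith [Nat.cast_nonneg (α := ℝ) n]) h.ne'
  simp only [bound]
  linarith

/-- The factor two is what later prevents two crossing members from being tight at once. -/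
theorem two_mul_bound_lt {i j : ℕ} (h : i < j) : 2 * bound n i < bound n j := by
  have h1 := bound_mono (n := n) (Nat.succ_le_of_lt h)
  have h2 : (1 : ℝ) ≤ (n + 2 : ℝ) ^ i := one_le_pow₀ (by linarith [Nat.cast_nonneg (α := ℝ) n])
  simp only [bound, Nat.succ_eq_add_one, pow_succ] at *
  have h3 := mul_nonneg (Nat.cast_nonneg (α := ℝ) n) (zero_le_one.trans h2)
  linarith

theorem bound_add_lt {i j : ℕ} (hi : 0 < i) (hj : 0 < j) : bound n i + bound n j < bound n (i + j) := by
  rcases le_total i j with h | h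
  · linarith [bound_mono (n := n) h, two_mul_bound_lt (n := n) (show j < i + j by omega)]
  · linarith [bound_mono (n := n) h, two_mul_bound_lt (n := n) (show i < i + j by omega)]

theorem sum_bound_le (hS : (S : Set (Finset (Fin n))).PairwiseDisjoint id) :
    ∑ I ∈ S, bound n I.card ≤ bound n (S.sup id).card := by
  induction S using Finset.induction_on with
  | empty => simp [bound_zero]
  | insert I S hI ih =>
    have hd : Disjoint I (S.sup id) := by
      rw [Finset.disjoint_sup_right]
      intro J hJ
      exact hS (by simp) (by simp [hJ]) (by rintro rfl; exact hI hJ)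
    rw [Finset.sum_insert hI, Finset.sup_insert, id, Finset.sup_eq_union,
      Finset.card_union_of_disjoint hd]
    linarith [ih (hS.subset (by simp)), bound_add_le (n := n) I.card (S.sup id).card]

theorem sum_bound_lt (hS : (S : Set (Finset (Fin n))).PairwiseDisjoint id) (h2 : 2 ≤ S.card)
    (hne : ∀ I ∈ S, I.Nonempty) :
    ∑ I ∈ S, bound n I.card < bound n (S.sup id).card := by
  obtain ⟨I, hI⟩ := Finset.card_pos.1 (by omega : 0 < S.card)
  have h1 : (S.erase I).card = S.card - 1 := Finset.card_erase_of_mem hI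
  obtain ⟨J, hJ⟩ := Finset.card_pos.1 (by omega : 0 < (S.erase I).card)
  have hd : Disjoint I ((S.erase I).sup id) := by
    rw [Finset.disjoint_sup_right]
    intro J hJ
    exact hS hI (Finset.mem_of_mem_erase hJ) (Finset.ne_of_mem_erase hJ).symm
  have hpos : 0 < ((S.erase I).sup id).card := by
    obtain ⟨j, hj⟩ := hne J (Finset.mem_of_mem_erase hJ)
    exact Finset.card_pos.2 ⟨j, Finset.mem_sup.2 ⟨J, hJ, hj⟩⟩
  rw [sup_eq_union_sup_erase hI, Finset.card_union_of_disjoint hd, ← Finset.add_sum_erase _ _ hI]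
  have := sum_bound_le (hS.subset (Finset.coe_subset.2 (S.erase_subset I)))
  linarith [bound_add_lt (n := n) (hne I hI).card_pos hpos]

/-- Coordinates realizing a nested collection, with prescribed large values outside of its union. -/
theorem IsNested.exists_coordinates (hB : IsBuildingSet B) (hN : IsNested B N) (d : Fin n → ℝ)
    (hd : ∀ i, (n + 2 : ℝ) ^ n ≤ d i) :
    ∃ x : Fin n → ℝ, (∀ I ∈ N, ∑ i ∈ I, x i = bound n I.card) ∧
      (∀ K ∈ B, K ∉ N → bound n K.card < ∑ i ∈ K, x i) ∧
      (∀ i, i ∉ N.sup id → x i = d i) ∧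
      ∀ L : Finset (Fin n), (∀ J ∈ N, J ⊆ L ∨ Disjoint J L) →
        ∑ i ∈ L ∩ N.sup id, x i ≤ bound n (L ∩ N.sup id).card := by
  have hpow : (0 : ℝ) < (n + 2 : ℝ) ^ n := by positivity
  have hbn : ∀ K : Finset (Fin n), bound n K.card < (n + 2 : ℝ) ^ n := fun K => by
    have := bound_mono (n := n) (card_finset_fin_le K)
    have h : bound n n = (n + 2 : ℝ) ^ n - 1 := rfl
    linarith
  induction h : N.card generalizing N with
  | zero =>
    obtain rfl := Finset.card_eq_zero.1 h
    refine ⟨d, by simp, fun K hK _ => ?_, by simp, by simp [bound_zero]⟩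
    obtain ⟨i, hi⟩ := hB.nonempty K hK
    exact (hbn K).trans_le ((hd i).trans
      (Finset.single_le_sum (fun j _ => hpow.le.trans (hd j)) hi))
  | succ k ih =>
    obtain ⟨K, hK, hmax⟩ := exists_maximal_mem (Finset.card_pos.1 (by omega : 0 < N.card))
    have hC := hN.sdiff_nonempty hB hK hmax
    have hN' := hN.mono (N.erase_subset K)
    obtain ⟨x, hx1, hx2, hx3, hx4⟩ := ih hN' (by rw [Finset.card_erase_of_mem hK, h]; rfl)
    have hsup := sup_eq_union_sup_erase hK
    set V := (N.erase K).sup id with hV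
    have hKJ : ∀ J ∈ N.erase K, J ⊆ K ∨ Disjoint J K := by
      intro J hJ
      rcases hN.disjoint_or_nested J (Finset.mem_of_mem_erase hJ) K hK with h | h | h
      · exact .inl h
      · exact absurd (hmax J (Finset.mem_of_mem_erase hJ) h) (Finset.ne_of_mem_erase hJ)
      · exact .inr h
    have hcard : (K \ V).card + (K ∩ V).card = K.card := Finset.card_sdiff_add_card_inter K V
    have hCpos := hC.card_pos
    -- The fourth conclusion is carried through the induction for this estimate: it leaves enough of
    -- the prescribed sum over `K` for the new coordinates.
    have hS : ∑ i ∈ K ∩ V, x i ≤ bound n (K.card - 1) :=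
      (hx4 K hKJ).trans (bound_mono (by omega))
    -- The common new value on the points of `K` outside the other members makes `K` tight.
    set y := (bound n K.card - ∑ i ∈ K ∩ V, x i) / (K \ V).card with hy
    have hCpos' : (0 : ℝ) < (K \ V).card := by exact_mod_cast hCpos
    have hyC : (K \ V).card * y = bound n K.card - ∑ i ∈ K ∩ V, x i :=
      mul_div_cancel₀ _ hCpos'.ne'
    -- At least `(n + 1) * (n + 2) ^ (K.card - 1)` is shared among at most `n` points; this is why
    -- the base is `n + 2`.
    have hylt : (n + 2 : ℝ) ^ (K.card - 1) < y := by
      have hCn : ((K \ V).card : ℝ) ≤ n := by exact_mod_cast card_finset_fin_le _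
      rw [hy, lt_div_iff₀ hCpos']
      have hp : (0 : ℝ) < (n + 2 : ℝ) ^ (K.card - 1) := by positivity
      have h1 := mul_le_mul_of_nonneg_left hCn hp.le
      have h2 : (n + 2 : ℝ) ^ K.card = (n + 2 : ℝ) ^ (K.card - 1) * (n + 2) := by
        rw [← pow_succ]; congr 1; omega
      have h3 : bound n K.card = (n + 2 : ℝ) ^ (K.card - 1) * (n + 2) - 1 := by rw [bound, h2]
      have h4 : bound n (K.card - 1) = (n + 2 : ℝ) ^ (K.card - 1) - 1 := rfl
      linarith
    have hxpos : ∀ i, 0 ≤ x i := by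
      intro i
      have hb : 0 < bound n 1 := bound_pos one_pos
      by_cases hi : {i} ∈ N.erase K
      · have := hx1 _ hi
        simp at this
        linarith
      · have := hx2 _ (hB.singleton i) hi
        simp at this
        linarith
    have hypos : 0 ≤ y := le_trans (by positivity) hylt.le
    have hzpos : ∀ i, 0 ≤ if i ∈ K \ V then y else x i := fun i => by
      split_ifs
      exacts [hypos, hxpos i]
    have hzx : ∀ L : Finset (Fin n), Disjoint L (K \ V) →
        ∑ i ∈ L, (if i ∈ K \ V then y else x i) = ∑ i ∈ L, x i := fun L hL =>
      Finset.sum_congr rfl fun i hi => if_neg (Finset.disjoint_left.1 hL hi)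
    have hzV : ∀ L, L ⊆ V → Disjoint L (K \ V) := fun L hL =>
      Finset.disjoint_sdiff.mono_left hL
    have hzK : ∑ i ∈ K, (if i ∈ K \ V then y else x i) = bound n K.card := by
      rw [← Finset.sum_inter_add_sum_sdiff K V, hzx _ (hzV _ Finset.inter_subset_right),
        Finset.sum_congr rfl (fun i hi => if_pos hi : ∀ i ∈ K \ V, _ = y), Finset.sum_const,
        nsmul_eq_mul, hyC]
      ring
    refine ⟨fun i => if i ∈ K \ V then y else x i, fun I hI => ?_, fun J hJ hJN => ?_,
      fun i hi => ?_, fun L hL => ?_⟩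
    · by_cases hIK : I = K
      · rw [hIK]
        exact hzK
      · have hI' : I ∈ N.erase K := Finset.mem_erase.2 ⟨hIK, hI⟩
        rw [hzx I (hzV I (Finset.le_sup (f := id) hI')), hx1 I hI']
    · by_cases hdis : Disjoint J (K \ V)
      · rw [hzx J hdis]
        exact hx2 J hJ fun h => hJN (Finset.mem_of_mem_erase h)
      · obtain ⟨r, hrJ, hr⟩ := Finset.not_disjoint_iff.1 hdis
        rw [Finset.mem_sdiff] at hr
        -- A set inside `K` is smaller than `K`, so the single coordinate `y` already exceeds its
        -- bound. A set reaching outside `K` is not covered by `N`, so it contains a point with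
        -- prescribed value at least `(n + 2) ^ n`.
        by_cases hJK : J ⊆ K
        · have hlt : J.card < K.card := Finset.card_lt_card
            (lt_of_le_of_ne hJK (by rintro rfl; exact hJN hK))
          have h1 : bound n J.card ≤ bound n (K.card - 1) := bound_mono (by omega)
          have h2 : y ≤ ∑ i ∈ J, (if i ∈ K \ V then y else x i) := by
            refine le_trans ?_ (Finset.single_le_sum (fun i _ => hzpos i) hrJ)
            rw [if_pos (Finset.mem_sdiff.2 hr)]
          have h3 : bound n (K.card - 1) = (n + 2 : ℝ) ^ (K.card - 1) - 1 := rfl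
          linarith
        · have hJsup : ¬ J ⊆ N.sup id := by
            intro hsub
            obtain ⟨M, hM, hJM⟩ := hN.exists_subset hB hJ hsub
            by_cases hMK : M = K
            · exact hJK (hMK ▸ hJM)
            · exact hr.2 (Finset.mem_sup.2 ⟨M, Finset.mem_erase.2 ⟨hMK, hM⟩, hJM hrJ⟩)
          obtain ⟨i, hiJ, hi⟩ := Finset.not_subset.1 hJsup
          rw [hsup, Finset.mem_union, not_or] at hi
          have h2 := Finset.single_le_sum (fun i _ => hzpos i) hiJ
          rw [if_neg (fun h => hi.1 (Finset.mem_sdiff.1 h).1), hx3 i hi.2] at h2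
          linarith [hbn J, hd i]
    · rw [hsup, Finset.mem_union, not_or] at hi
      exact (if_neg (fun h => hi.1 (Finset.mem_sdiff.1 h).1)).trans (hx3 i hi.2)
    · rcases hL K hK with hKL | hKL
      · have h1 : L ∩ N.sup id = K ∪ (L \ K) ∩ V := by
          rw [hsup]
          ext i
          have := @hKL i
          simp only [Finset.mem_inter, Finset.mem_union, Finset.mem_sdiff]
          tauto
        have h2 : Disjoint K ((L \ K) ∩ V) :=
          Finset.disjoint_sdiff.mono_right Finset.inter_subset_left
        have h3 := hx4 (L \ K) fun J hJ => by
          rcases hKJ J hJ with h | h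
          · exact .inr (Finset.disjoint_sdiff.mono_left h)
          · rcases hL J (Finset.mem_of_mem_erase hJ) with h' | h'
            · exact .inl (Finset.subset_sdiff.2 ⟨h', h⟩)
            · exact .inr (h'.mono_right Finset.sdiff_subset)
        rw [h1, Finset.sum_union h2, Finset.card_union_of_disjoint h2, hzK,
          hzx _ (hzV _ Finset.inter_subset_right)]
        linarith [bound_add_le (n := n) K.card ((L \ K) ∩ V).card]
      · have h1 : L ∩ N.sup id = L ∩ V := by
          rw [hsup, Finset.inter_union_distrib_left, Finset.disjoint_iff_inter_eq_empty.1 hKL.symm,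
            Finset.empty_union]
        rw [h1, hzx _ (hzV _ Finset.inter_subset_right)]
        exact hx4 L fun J hJ => hL J (Finset.mem_of_mem_erase hJ)

end Realization

/-! ### The explicit extended nestohedron. -/

section Realization
variable {n : ℕ} {B : Finset (Finset (Fin n))}

open Classical in
/-- The functionals of the inequalities `∑_{i ∈ I} xᵢ ≥ (n + 2)^|I| - 1`, `I ∈ B`, and
`xᵢ ≤ (n + 2)ⁿ + 1`; those indexed by sets outside of `B` are trivial. -/
noncomputable def nestFunctional (B : Finset (Finset (Fin n))) :
    Finset (Fin n) ⊕ Fin n → StrongDual ℝ (EuclideanSpace ℝ (Fin n))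
  | .inl I => if I ∈ B then -∑ i ∈ I, EuclideanSpace.proj i else 0
  | .inr i => EuclideanSpace.proj i

open Classical in
/-- The right hand sides of the inequalities with functionals `nestFunctional B`. -/
noncomputable def nestBound (B : Finset (Finset (Fin n))) : Finset (Fin n) ⊕ Fin n → ℝ
  -- The default `1` against the zero functional gives `0 ≤ 1`, never tight, so sets outside `B`
  -- never enter an active set.
  | .inl I => if I ∈ B then -bound n I.card else 1
  | .inr _ => (n + 2 : ℝ) ^ n + 1

theorem nestFunctional_inl {I : Finset (Fin n)} (hI : I ∈ B) (x : EuclideanSpace ℝ (Fin n)) :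
    nestFunctional B (.inl I) x = -∑ i ∈ I, x i := by
  simp [nestFunctional, hI]

theorem nestBound_inl {I : Finset (Fin n)} (hI : I ∈ B) :
    nestBound B (.inl I) = -bound n I.card := by
  simp [nestBound, hI]

theorem inl_mem_activeSet_iff {I : Finset (Fin n)} {x : EuclideanSpace ℝ (Fin n)} :
    Sum.inl I ∈ activeSet (nestFunctional B) (nestBound B) x ↔
      I ∈ B ∧ ∑ i ∈ I, x i = bound n I.card := by
  rw [mem_activeSet]
  by_cases hI : I ∈ B
  · simp [nestFunctional_inl hI, nestBound_inl hI, hI]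
  · simp [nestFunctional, nestBound, hI]

theorem inr_mem_activeSet_iff {i : Fin n} {x : EuclideanSpace ℝ (Fin n)} :
    Sum.inr i ∈ activeSet (nestFunctional B) (nestBound B) x ↔ x i = (n + 2 : ℝ) ^ n + 1 := by
  rw [mem_activeSet]
  rfl

theorem mem_nestPolyhedron_iff {x : EuclideanSpace ℝ (Fin n)} :
    x ∈ polyhedron (nestFunctional B) (nestBound B) ↔
      (∀ I ∈ B, bound n I.card ≤ ∑ i ∈ I, x i) ∧ ∀ i, x i ≤ (n + 2 : ℝ) ^ n + 1 := by
  constructor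
  · refine fun h => ⟨fun I hI => ?_, fun i => h (.inr i)⟩
    have := h (.inl I)
    rw [nestFunctional_inl hI, nestBound_inl hI] at this
    linarith
  · rintro ⟨h1, h2⟩ (I | i)
    · by_cases hI : I ∈ B
      · rw [nestFunctional_inl hI, nestBound_inl hI]
        linarith [h1 I hI]
      · simp [nestFunctional, nestBound, hI]
    · exact h2 i

theorem pos_of_mem_nestPolyhedron (hB : IsBuildingSet B) {x : EuclideanSpace ℝ (Fin n)}
    (hx : x ∈ polyhedron (nestFunctional B) (nestBound B)) (i : Fin n) : 0 < x i := by
  have h1 := (mem_nestPolyhedron_iff.1 hx).1 _ (hB.singleton i)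
  have h2 : 0 < bound n 1 := bound_pos one_pos
  simp only [Finset.card_singleton, Finset.sum_singleton] at h1
  linarith

theorem isBounded_nestPolyhedron (hB : IsBuildingSet B) :
    Bornology.IsBounded (polyhedron (nestFunctional B) (nestBound B)) := by
  refine isBounded_iff_forall_norm_le.2 ⟨√(∑ _i : Fin n, ((n + 2 : ℝ) ^ n + 1) ^ 2), fun x hx => ?_⟩
  rw [EuclideanSpace.norm_eq]
  refine Real.sqrt_le_sqrt (Finset.sum_le_sum fun i _ => ?_)
  have h0 := pos_of_mem_nestPolyhedron hB hx i
  rw [Real.norm_of_nonneg h0.le]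
  exact pow_le_pow_left₀ h0.le ((mem_nestPolyhedron_iff.1 hx).2 i) 2

/-- Coordinates are positive, so tight crossing sets would make the sum over their union too small;
tight disjoint sets with union in `B` would contradict strict superadditivity of `bound`; and a
coordinate inside a tight set is too small to reach its upper bound. -/
theorem isExtendedNested_activeSet (hB : IsBuildingSet B) {x : EuclideanSpace ℝ (Fin n)}
    (hx : x ∈ polyhedron (nestFunctional B) (nestBound B)) :
    IsExtendedNested B (activeSet (nestFunctional B) (nestBound B) x) := by
  have hpos := pos_of_mem_nestPolyhedron hB hx
  obtain ⟨hlow, -⟩ := mem_nestPolyhedron_iff.1 hx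
  refine ⟨fun I hI => (inl_mem_activeSet_iff.1 hI).1, fun I J hI hJ => ?_,
    fun T hT h2 hdis hTB => ?_, fun I i hI hi hiI => ?_⟩
  · rw [inl_mem_activeSet_iff] at hI hJ
    by_contra! h
    obtain ⟨hIJ, hJI, hdis⟩ := h
    have h1 := hlow _ (hB.union I hI.1 J hJ.1 (Finset.not_disjoint_iff_nonempty_inter.1 hdis))
    have h2 := Finset.sum_union_inter (s₁ := I) (s₂ := J) (f := fun i => x i)
    have h3 : 0 ≤ ∑ i ∈ I ∩ J, x i := Finset.sum_nonneg fun i _ => (hpos i).le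
    have h4 : I.card < (I ∪ J).card := Finset.card_lt_card
      (Finset.ssubset_iff_subset_ne.2 ⟨Finset.subset_union_left, fun h =>
        hJI (Finset.union_eq_left.1 h.symm)⟩)
    have h5 : J.card < (I ∪ J).card := Finset.card_lt_card
      (Finset.ssubset_iff_subset_ne.2 ⟨Finset.subset_union_right, fun h =>
        hIJ (Finset.union_eq_right.1 h.symm)⟩)
    linarith [two_mul_bound_lt (n := n) h4, two_mul_bound_lt (n := n) h5, hI.2, hJ.2]
  · have h1 := hlow _ hTB
    have h3 := sum_bound_lt hdis h2 fun I hI =>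
      hB.nonempty I (inl_mem_activeSet_iff.1 (hT I hI)).1
    rw [Finset.sup_eq_biUnion, Finset.sum_biUnion hdis, ← Finset.sup_eq_biUnion] at h1
    have h4 : ∑ I ∈ T, ∑ i ∈ id I, x i = ∑ I ∈ T, bound n I.card :=
      Finset.sum_congr rfl fun I hI => (inl_mem_activeSet_iff.1 (hT I hI)).2
    linarith
  · rw [inl_mem_activeSet_iff] at hI
    rw [inr_mem_activeSet_iff] at hi
    have h1 := Finset.single_le_sum (f := fun i => x i) (fun j _ => (hpos j).le) hiI
    have h2 := bound_mono (n := n) (card_finset_fin_le I)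
    have h3 : bound n n = (n + 2 : ℝ) ^ n - 1 := rfl
    linarith [hI.2]

theorem exists_activeSet_eq (hB : IsBuildingSet B) {N : Finset (Finset (Fin n) ⊕ Fin n)}
    (hN : IsExtendedNested B N) : ∃ x ∈ polyhedron (nestFunctional B) (nestBound B),
      activeSet (nestFunctional B) (nestBound B) x = N := by
  classical
  obtain ⟨hN', hdis⟩ := isExtendedNested_iff.1 hN
  obtain ⟨x, hx1, hx2, hx3, -⟩ := hN'.exists_coordinates hB
    -- Both values are large enough for `IsNested.exists_coordinates`, but only the first makes the
    -- upper bound tight.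
    (fun i => if Sum.inr i ∈ N then (n + 2 : ℝ) ^ n + 1 else (n + 2 : ℝ) ^ n)
    (fun i => by split_ifs <;> linarith)
  have hlow : ∀ I ∈ B, bound n I.card ≤ ∑ i ∈ I, x i := fun I hI => by
    by_cases h : I ∈ N.toLeft
    exacts [(hx1 I h).ge, (hx2 I hI h).le]
  have hpos : ∀ i, 0 ≤ x i := fun i => by
    have h1 := hlow _ (hB.singleton i)
    have h2 : 0 < bound n 1 := bound_pos one_pos
    simp only [Finset.card_singleton, Finset.sum_singleton] at h1
    linarith
  have hin : ∀ i ∈ N.toLeft.sup id, x i < (n + 2 : ℝ) ^ n := by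
    intro i hi
    obtain ⟨I, hI, hiI⟩ := Finset.mem_sup.1 hi
    have h1 := Finset.single_le_sum (f := x) (fun j _ => hpos j) hiI
    have h2 := bound_mono (n := n) (card_finset_fin_le I)
    have h3 : bound n n = (n + 2 : ℝ) ^ n - 1 := rfl
    have h4 : ∑ i ∈ id I, x i = bound n I.card := hx1 I hI
    linarith
  refine ⟨WithLp.toLp 2 x, mem_nestPolyhedron_iff.2 ⟨hlow, fun i => ?_⟩, ?_⟩
  · by_cases hi : i ∈ N.toLeft.sup id
    · have := hin i hi
      simp only
      linarith
    · simp only [hx3 i hi]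
      split_ifs <;> linarith
  · ext (I | i)
    · rw [inl_mem_activeSet_iff, ← Finset.mem_toLeft]
      refine ⟨fun h => ?_, fun h => ⟨hN'.mem I h, hx1 I h⟩⟩
      by_contra hc
      exact (hx2 I h.1 hc).ne' h.2
    · rw [inr_mem_activeSet_iff]
      by_cases hi : i ∈ N.toLeft.sup id
      · have h1 := hin i hi
        refine ⟨fun h => ?_, fun h => ?_⟩
        · simp only at h
          linarith
        · exact absurd hi (Finset.disjoint_left.1 hdis (Finset.mem_toRight.2 h))
      · simp only [hx3 i hi]
        split_ifs with h <;> simp [h]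

/-- Every building set on `[n]` has an extended nestohedron, of dimension `n`. -/
theorem IsBuildingSet.exists_isExtendedNestohedron (hB : IsBuildingSet B) :
    ∃ P : Set (EuclideanSpace ℝ (Fin n)), IsExtendedNestohedron B P ∧ dim P = n := by
  -- A point with no tight inequality is interior, which gives full dimension.
  obtain ⟨x, hx, hxe⟩ := exists_activeSet_eq hB isExtendedNested_empty
  exact ⟨polyhedron (nestFunctional B) (nestBound B),
    ⟨isPolytope_polyhedron (isBounded_nestPolyhedron hB),
      ⟨polyhedronFaceIso fun N => ⟨exists_activeSet_eq hB, by
        rintro ⟨x, hx, rfl⟩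
        exact isExtendedNested_activeSet hB hx⟩⟩⟩, dim_polyhedron hx hxe⟩

end Realization

/-! ### From the face poset to the f-polynomial. -/

section FVector
variable {n m : ℕ} {B : Finset (Finset (Fin n))} {P : Set (EuclideanSpace ℝ (Fin m))}

theorem isFace_self (hP : P.Nonempty) : IsFace P P := ⟨IsExposed.refl P, hP⟩

theorem coe_symm_toDual_empty (e : Face P ≃o (ExtendedNestedComplex B)ᵒᵈ) :
    (e.symm (OrderDual.toDual ⟨∅, isExtendedNested_empty⟩)).1 = P := by
  set F := e.symm (OrderDual.toDual ⟨∅, isExtendedNested_empty⟩) with hF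
  refine F.2.subset.antisymm ?_
  have hP : P.Nonempty := F.2.2.mono F.2.subset
  have : (⟨P, isFace_self hP⟩ : Face P) ≤ F := by
    rw [hF, e.le_symm_apply]
    exact Finset.empty_subset _
  exact this

theorem toDual_covBy {N : Finset (Finset (Fin n) ⊕ Fin n)} {v : Finset (Fin n) ⊕ Fin n}
    (hv : v ∉ N) (hN : IsExtendedNested B (insert v N)) :
    (OrderDual.toDual (⟨insert v N, hN⟩ : ExtendedNestedComplex B)) ⋖
      OrderDual.toDual ⟨N, hN.mono (Finset.subset_insert v N)⟩ := by
  rw [toDual_covBy_toDual_iff]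
  have := Finset.covBy_insert hv
  exact ⟨this.1, fun c h1 h2 => this.2 (c := c.1) h1 h2⟩

/-- Adding one vertex to a collection is a cover, so the dual face loses exactly one dimension. -/
theorem dim_add_card (hP : IsPolytope P) (e : Face P ≃o (ExtendedNestedComplex B)ᵒᵈ)
    (N : ExtendedNestedComplex B) :
    dim (e.symm (OrderDual.toDual N)).1 + N.1.card = dim P := by
  obtain ⟨N, hN⟩ := N
  induction N using Finset.induction_on with
  | empty => rw [coe_symm_toDual_empty]; simp
  | insert v N hv ih =>
    have h := Face.dim_eq_of_covBy hP ((apply_covBy_apply_iff e.symm).2 (toDual_covBy hv hN))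
    rw [← ih (hN.mono (Finset.subset_insert v N)), h, Finset.card_insert_of_notMem hv]
    ring

/-- Dimension is invariant under combinatorial equivalence, so comparison with the explicit
realization suffices. -/
theorem IsExtendedNestohedron.dim_eq (hB : IsBuildingSet B) (hP : IsExtendedNestohedron B P) :
    dim P = n := by
  obtain ⟨hP, ⟨e⟩⟩ := hP
  obtain ⟨Q, ⟨hQ, ⟨e'⟩⟩, hdim⟩ := hB.exists_isExtendedNestohedron
  have h := Face.dim_orderIso hP hQ (e.trans e'.symm)
    (e.symm (OrderDual.toDual ⟨∅, isExtendedNested_empty⟩))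
  rw [OrderIso.trans_apply, e.apply_symm_apply, coe_symm_toDual_empty, coe_symm_toDual_empty] at h
  omega

open Classical in
/-- The `f`-polynomial of an extended nestohedron counts extended nested collections by
codimension. -/
theorem IsExtendedNestohedron.fPoly_eq (hB : IsBuildingSet B) (hP : IsExtendedNestohedron B P) :
    fPoly P = ∑ N ∈ Finset.univ.filter (IsExtendedNested B),
      (Polynomial.X : Polynomial ℤ) ^ (n - N.card) := by
  have hdim := hP.dim_eq hB
  obtain ⟨hP, ⟨e⟩⟩ := hP
  have hcard : ∀ i, faceNumber P i =
      ((Finset.univ.filter (IsExtendedNested B)).filter (fun N => n - N.card = i)).card := by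
    intro i
    rw [faceNumber, ← Set.ncard_coe_finset]
    symm
    refine Set.ncard_congr (fun N hN => (e.symm (OrderDual.toDual
      ⟨N, (Finset.mem_filter.1 (Finset.mem_filter.1 hN).1).2⟩)).1) ?_ ?_ ?_
    · intro N hN
      have h := Finset.mem_filter.1 hN
      refine ⟨(e.symm _).2, ?_⟩
      have := dim_add_card hP e ⟨N, (Finset.mem_filter.1 h.1).2⟩
      simp only at this
      omega
    · intro N N' hN hN' h
      have := e.symm.injective (Subtype.ext h)
      exact congrArg Subtype.val (OrderDual.toDual.injective this)
    · rintro F ⟨hF, hFi⟩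
      refine ⟨(OrderDual.ofDual (e ⟨F, hF⟩)).1, ?_, ?_⟩
      · have := dim_add_card hP e (OrderDual.ofDual (e ⟨F, hF⟩))
        simp only [OrderDual.toDual_ofDual, OrderIso.symm_apply_apply] at this
        simp only [Finset.coe_filter, Finset.mem_filter, Finset.mem_univ, true_and,
          Set.mem_ofPred_eq]
        exact ⟨(OrderDual.ofDual (e ⟨F, hF⟩)).2, by omega⟩
      · simp
  have hmaps : ∀ N ∈ Finset.univ.filter (IsExtendedNested B), n - N.card ∈
      Finset.range (dim P + 1) := fun N _ => Finset.mem_range.2 (by omega)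
  rw [fPoly, ← Finset.sum_fiberwise_of_maps_to hmaps]
  refine Finset.sum_congr rfl fun i _ => ?_
  rw [Finset.sum_congr rfl (fun N hN => by rw [(Finset.mem_filter.1 hN).2] :
    ∀ N ∈ _, _ = (Polynomial.X : Polynomial ℤ) ^ i), Finset.sum_const, hcard]
  simp

end FVector

open Polynomial

/-! ### Connected components of restrictions. -/

section Component
variable {n : ℕ} {B N N' : Finset (Finset (Fin n))} {U I C : Finset (Fin n)} {a b : Fin n}

/-- The connected component of `a` in `B|_U`. -/
def component (B : Finset (Finset (Fin n))) (U : Finset (Fin n)) (a : Fin n) : Finset (Fin n) :=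
  (B.filter (fun I => I ⊆ U ∧ a ∈ I)).sup id

theorem mem_component_iff : b ∈ component B U a ↔ ∃ I ∈ B, I ⊆ U ∧ a ∈ I ∧ b ∈ I := by
  simp [component, Finset.mem_sup, and_assoc]

theorem component_subset : component B U a ⊆ U := by
  intro b hb
  obtain ⟨I, -, hI, -, hbI⟩ := mem_component_iff.1 hb
  exact hI hbI

theorem self_mem_component (hB : IsBuildingSet B) (ha : a ∈ U) : a ∈ component B U a :=
  mem_component_iff.2 ⟨{a}, hB.singleton a, by simpa using ha, by simp, by simp⟩

theorem component_mem (hB : IsBuildingSet B) (ha : a ∈ U) : component B U a ∈ B := by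
  have h := hB.union_sup_mem (hB.singleton a) (S := B.filter (fun I => I ⊆ U ∧ a ∈ I))
    fun I hI => by
      rw [Finset.mem_filter] at hI
      exact ⟨hI.1, a, by simp [hI.2.2]⟩
  rwa [Finset.union_eq_right.2] at h
  rw [Finset.singleton_subset_iff]
  exact self_mem_component hB ha

theorem subset_component (hB : IsBuildingSet B) (ha : a ∈ U) (hI : I ∈ B) (hIU : I ⊆ U)
    (h : (I ∩ component B U a).Nonempty) : I ⊆ component B U a := by
  intro b hb
  exact mem_component_iff.2 ⟨_, hB.union I hI _ (component_mem hB ha) h,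
    Finset.union_subset hIU component_subset,
    Finset.mem_union_right _ (self_mem_component hB ha), Finset.mem_union_left _ hb⟩

theorem sameComponent_restrict_iff :
    SameComponent (restrict B U) a b ↔ b ∈ component B U a := by
  rw [mem_component_iff]
  constructor
  · rintro ⟨M, hM, ha, hb⟩
    have := Finset.mem_filter.1 hM.1
    exact ⟨M, this.1, this.2, ha, hb⟩
  · rintro ⟨I, hI, hIU, ha, hb⟩
    obtain ⟨M, hIM, hM⟩ := (restrict B U).exists_le_maximal (Finset.mem_filter.2 ⟨hI, hIU⟩)
    exact ⟨M, hM, hIM ha, hIM hb⟩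

/-- The component is covered by `N`, hence contained in one member, which cannot be larger by
maximality of the component. -/
theorem IsNested.component_mem (hB : IsBuildingSet B) (hN : IsNested B N) (hU : N.sup id = U)
    (ha : a ∈ U) : component B U a ∈ N := by
  obtain ⟨J, hJ, hKJ⟩ := hN.exists_subset hB (ExtNest.component_mem hB ha)
    (component_subset.trans hU.ge)
  have := subset_component hB ha (hN.mem J hJ) (hU ▸ Finset.le_sup (f := id) hJ)
    ⟨a, Finset.mem_inter.2 ⟨hKJ (self_mem_component hB ha), self_mem_component hB ha⟩⟩
  rwa [hKJ.antisymm this]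

/-- Members of `B` inside `U` lie in the component or miss it. A forbidden disjoint union involving
the component would lie inside it, leaving no room for its other parts. -/
theorem IsNested.insert_component (hB : IsBuildingSet B) (hN : IsNested B N) (hU : N.sup id ⊆ U)
    (ha : a ∈ U) : IsNested B (insert (component B U a) N) := by
  have hNU : ∀ I ∈ N, I ⊆ U := fun I hI => (Finset.le_sup (f := id) hI).trans hU
  have hnd : ∀ I ∈ N, I ⊆ component B U a ∨ Disjoint I (component B U a) := by
    intro I hI
    rw [or_iff_not_imp_right, Finset.not_disjoint_iff_nonempty_inter]
    exact subset_component hB ha (hN.mem I hI) (hNU I hI)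
  have hK := ExtNest.component_mem hB ha
  refine ⟨?_, ?_, fun T hT h2 hdis hTB => ?_⟩
  · simpa [hK] using hN.mem
  · intro I hI J hJ
    rw [Finset.mem_insert] at hI hJ
    rcases hI with rfl | hI <;> rcases hJ with rfl | hJ
    · exact .inl subset_rfl
    · exact .inr ((hnd J hJ).imp id fun h => h.symm)
    · rcases hnd I hI with h | h
      exacts [.inl h, .inr (.inr h)]
    · exact hN.disjoint_or_nested I hI J hJ
  · by_cases hKT : component B U a ∈ T
    · have hsub : T.sup id ⊆ U := Finset.sup_le fun I hI => by
        rcases Finset.mem_insert.1 (hT hI) with rfl | h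
        exacts [component_subset, hNU I h]
      have hKsub : component B U a ⊆ T.sup id := Finset.le_sup (f := id) hKT
      have haK := self_mem_component hB ha
      have hle := subset_component hB ha hTB hsub
        ⟨a, Finset.mem_inter.2 ⟨hKsub haK, haK⟩⟩
      obtain ⟨J, hJ, hne⟩ := Finset.exists_mem_ne (by omega : 1 < T.card) (component B U a)
      have hJB : J ∈ B := by
        rcases Finset.mem_insert.1 (hT hJ) with rfl | h
        exacts [hK, hN.mem J h]
      obtain ⟨i, hi⟩ := hB.nonempty J hJB
      exact Finset.disjoint_left.1 (hdis hJ hKT hne) hi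
        (hle (Finset.le_sup (f := id) hJ hi))
    · exact hN.union_notMem T (fun I hI => (Finset.mem_insert.1 (hT hI)).resolve_left
        fun h => hKT (h ▸ hI)) h2 hdis hTB

end Component

/-! ### Generating polynomials of nested collections and their recursion. -/

section NestedPoly
variable {n : ℕ} {B N N' : Finset (Finset (Fin n))} {U I C : Finset (Fin n)} {a b : Fin n}

open Classical in
/-- The nested collections with union `U`. -/
noncomputable def nestedOn (B : Finset (Finset (Fin n))) (U : Finset (Fin n)) :
    Finset (Finset (Finset (Fin n))) :=
  Finset.univ.filter (fun N => IsNested B N ∧ N.sup id = U)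

theorem mem_nestedOn : N ∈ nestedOn B U ↔ IsNested B N ∧ N.sup id = U := by
  simp [nestedOn]

/-- The generating polynomial of the nested collections with union `U`. -/
noncomputable def nestedPoly (B : Finset (Finset (Fin n))) (U : Finset (Fin n)) : ℤ[X] :=
  ∑ N ∈ nestedOn B U, X ^ (U.card - N.card)

theorem nestedPoly_empty (hB : IsBuildingSet B) : nestedPoly B ∅ = 1 := by
  have : nestedOn B ∅ = {∅} := by
    ext N
    rw [mem_nestedOn, Finset.mem_singleton]
    constructor
    · rintro ⟨hN, hs⟩
      have := hN.card_le hB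
      rw [hs] at this
      simpa using this
    · rintro rfl
      refine ⟨⟨by simp, by simp, fun T hT h2 => ?_⟩, rfl⟩
      rw [Finset.subset_empty.1 hT] at h2
      simp at h2
  simp [nestedPoly, this]

/-- Removing the component of `a`, with `a ∈ U`, from the nested collections with union `U`. -/
theorem nestedPoly_eq (hB : IsBuildingSet B) (ha : a ∈ U) :
    nestedPoly B U = ∑ C ∈ (component B U a).powerset.erase ∅,
      X ^ (C.card - 1) * nestedPoly B (U \ C) := by
  set K := component B U a with hK
  have hKU : K ⊆ U := component_subset
  have hcomp : ∀ N ∈ nestedOn B U, K ∈ N ∧ U \ (N.erase K).sup id ⊆ K ∧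
      (U \ (N.erase K).sup id).Nonempty ∧ (N.erase K).sup id ⊆ U := by
    intro N hN
    obtain ⟨hN, hs⟩ := mem_nestedOn.1 hN
    have hKN : K ∈ N := hN.component_mem hB hs ha
    have hun := sup_eq_union_sup_erase hKN
    rw [hs] at hun
    have hmax : ∀ J ∈ N, K ⊆ J → J = K := fun J hJ hKJ =>
      (subset_component hB ha (hN.mem J hJ) (hs ▸ Finset.le_sup (f := id) hJ)
        ⟨a, Finset.mem_inter.2 ⟨hKJ (self_mem_component hB ha), self_mem_component hB ha⟩⟩).antisymm
        hKJ
    refine ⟨hKN, ?_, (hN.sdiff_nonempty hB hKN hmax).mono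
      (Finset.sdiff_subset_sdiff hKU subset_rfl), hun ▸ Finset.subset_union_right⟩
    exact sdiff_le_iff.2 (hun.le.trans (Finset.union_comm _ _).le)
  simp only [nestedPoly, Finset.mul_sum]
  rw [Finset.sum_sigma']
  refine Finset.sum_bij'
    -- `C` records the points of `U` covered only by `K`.
    (fun N _ => (⟨U \ (N.erase K).sup id, N.erase K⟩ :
      (_ : Finset (Fin n)) × Finset (Finset (Fin n))))
    (fun p _ => insert K p.2) ?_ ?_ ?_ ?_ ?_
  · intro N hN
    obtain ⟨h1, h2, h3, h4⟩ := hcomp N hN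
    simp only [Finset.mem_sigma, Finset.mem_erase, Finset.mem_powerset]
    exact ⟨⟨h3.ne_empty, h2⟩, mem_nestedOn.2
      ⟨(mem_nestedOn.1 hN).1.mono (N.erase_subset K), (Finset.sdiff_sdiff_eq_self h4).symm⟩⟩
  · rintro ⟨C, N'⟩ hp
    simp only [Finset.mem_sigma, Finset.mem_erase, Finset.mem_powerset] at hp
    obtain ⟨⟨hC, hCK⟩, hN'⟩ := hp
    obtain ⟨hN', hs⟩ := mem_nestedOn.1 hN'
    refine mem_nestedOn.2 ⟨hN'.insert_component hB (hs ▸ Finset.sdiff_subset) ha, ?_⟩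
    rw [Finset.sup_insert, hs, id, Finset.sup_eq_union]
    ext i
    have h1 := @hKU i
    have h2 := @hCK i
    simp only [Finset.mem_union, Finset.mem_sdiff]
    tauto
  · intro N hN
    exact Finset.insert_erase (hcomp N hN).1
  · rintro ⟨C, N'⟩ hp
    simp only [Finset.mem_sigma, Finset.mem_erase, Finset.mem_powerset] at hp
    obtain ⟨⟨hC, hCK⟩, hN'⟩ := hp
    obtain ⟨hN', hs⟩ := mem_nestedOn.1 hN'
    have hKN' : K ∉ N' := by
      intro h
      obtain ⟨i, hi⟩ := Finset.nonempty_iff_ne_empty.2 hC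
      have : i ∈ N'.sup id := Finset.le_sup (f := id) h (hCK hi)
      rw [hs] at this
      exact (Finset.mem_sdiff.1 this).2 hi
    simp only [Finset.erase_insert hKN', hs, Finset.sdiff_sdiff_eq_self (hCK.trans hKU)]
  · intro N hN
    obtain ⟨h1, h2, h3, h4⟩ := hcomp N hN
    simp only
    rw [← pow_add, Finset.sdiff_sdiff_eq_self h4, Finset.card_erase_of_mem h1]
    congr 1
    have h5 := ((mem_nestedOn.1 hN).1.mono (N.erase_subset K)).card_le hB
    rw [Finset.card_erase_of_mem h1] at h5
    have h6 := h3.card_pos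
    have h7 := Finset.card_sdiff_add_card_eq_card h4
    have h8 := Finset.card_pos.2 ⟨K, h1⟩
    omega

/-- Splitting the extended nested collections according to the union of their members. -/
theorem sum_isExtendedNested (hB : IsBuildingSet B) [DecidablePred (IsExtendedNested B)] :
    ∑ N ∈ Finset.univ.filter (IsExtendedNested B), (X : ℤ[X]) ^ (n - N.card) =
      ∑ U, (X + 1) ^ (n - U.card) * nestedPoly B U := by
  have hexp : ∀ U : Finset (Fin n), (X + 1 : ℤ[X]) ^ (n - U.card) =
      ∑ D ∈ Uᶜ.powerset, X ^ (Uᶜ.card - D.card) := by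
    intro U
    -- Binomial expansion over the sets `D` of design vertices, which are free subsets of the
    -- complement of `U`.
    have := Finset.sum_pow_mul_eq_add_pow (1 : ℤ[X]) X Uᶜ
    simp only [one_pow, one_mul] at this
    rw [this, Finset.card_compl, Fintype.card_fin, add_comm]
  simp only [hexp, nestedPoly, Finset.sum_mul_sum]
  simp only [Finset.sum_sigma']
  refine Finset.sum_bij'
    (fun N _ => (⟨N.toLeft.sup id, N.toRight, N.toLeft⟩ : (_ : Finset (Fin n)) ×
      (_ : Finset (Fin n)) × Finset (Finset (Fin n))))
    (fun p _ => p.2.2.disjSum p.2.1) ?_ ?_ ?_ ?_ ?_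
  · intro N hN
    obtain ⟨h1, h2⟩ := isExtendedNested_iff.1 (Finset.mem_filter.1 hN).2
    simp only [Finset.mem_sigma, Finset.mem_univ, true_and, Finset.mem_powerset, mem_nestedOn,
      and_true]
    exact ⟨Finset.subset_compl_iff_disjoint_right.2 h2, h1⟩
  · rintro ⟨U, D, N⟩ hp
    simp only [Finset.mem_sigma, Finset.mem_univ, true_and, Finset.mem_powerset, mem_nestedOn] at hp
    obtain ⟨h1, h2, rfl⟩ := hp
    rw [Finset.mem_filter, isExtendedNested_iff]
    simpa [h2] using Finset.subset_compl_iff_disjoint_right.1 h1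
  · intro N hN
    exact Finset.toLeft_disjSum_toRight
  · rintro ⟨U, D, N⟩ hp
    simp only [Finset.mem_sigma, Finset.mem_univ, true_and, Finset.mem_powerset, mem_nestedOn] at hp
    obtain ⟨h1, h2, rfl⟩ := hp
    simp
  · intro N hN
    obtain ⟨h1, h2⟩ := isExtendedNested_iff.1 (Finset.mem_filter.1 hN).2
    simp only
    rw [← pow_add]
    congr 1
    have h3 := h1.card_le hB
    have h4 := Finset.card_le_card (Finset.subset_compl_iff_disjoint_right.2 h2)
    have h5 : N.card = N.toLeft.card + N.toRight.card := (Finset.card_toLeft_add_card_toRight).symm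
    rw [Finset.card_compl, Fintype.card_fin] at h4 ⊢
    have h6 := card_finset_fin_le (N.toLeft.sup id)
    omega

end NestedPoly

/-! ### Ascents and descents of words. -/

section Descents
variable {α : Type*} [LinearOrder α]

/-- The number of ascents of a word. -/
def ascents : List α → ℕ
  | a :: b :: l => (if a < b then 1 else 0) + ascents (b :: l)
  | _ => 0

/-- The number of descents of a word. -/
def descents : List α → ℕ
  | a :: b :: l => (if b < a then 1 else 0) + descents (b :: l)
  | _ => 0

theorem descents_append_cons (l r : List α) (b : α) :
    descents (l ++ b :: r) = descents (l ++ [b]) + descents (b :: r) := by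
  induction l with
  | nil => simp [descents]
  | cons x l ih =>
    cases l with
    | nil => simp [descents]
    | cons y l => simpa [descents, add_assoc] using ih

theorem descents_reverse (l : List α) : descents l.reverse = ascents l := by
  induction l with
  | nil => rfl
  | cons a l ih =>
    cases l with
    | nil => rfl
    | cons b l =>
      rw [List.reverse_cons, List.reverse_cons, List.append_assoc, List.singleton_append,
        descents_append_cons, ← List.reverse_cons, ih]
      simp [ascents, descents, add_comm]

theorem descents_append_singleton {l : List α} {b : α} (h : ∀ a ∈ l, a ≤ b) :
    descents (l ++ [b]) = descents l := by
  induction l with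
  | nil => rfl
  | cons x l ih =>
    have ih := ih fun a ha => h a (List.mem_cons_of_mem _ ha)
    cases l with
    | nil => simpa [descents] using h
    | cons y l => simpa [descents] using ih

theorem descents_of_pairwise {l : List α} (h : l.Pairwise (· > ·)) :
    descents l = l.length - 1 := by
  induction l with
  | nil => rfl
  | cons x l ih =>
    have ih := ih h.of_cons
    cases l with
    | nil => rfl
    | cons y l =>
      have hxy : y < x := (List.pairwise_cons.1 h).1 y (by simp)
      simp only [descents, ih, if_pos hxy, List.length_cons]
      omega

theorem descents_map {β : Type*} [LinearOrder β] {f : α → β} (hf : StrictMono f) (l : List α) :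
    descents (l.map f) = descents l := by
  induction l with
  | nil => rfl
  | cons x l ih =>
    cases l with
    | nil => rfl
    | cons y l =>
      simp only [List.map_cons] at ih
      simp [descents, ih, hf.lt_iff_lt]

theorem sum_ite_lt_eq_descents (n : ℕ) (l : List α) (h : l.length = n + 1) :
    (∑ i : Fin n, if l[(i : ℕ) + 1] < l[(i : ℕ)] then 1 else 0) = descents l := by
  induction n generalizing l with
  | zero =>
    obtain ⟨a, rfl⟩ := List.length_eq_one_iff.1 h
    rfl
  | succ n ih =>
    match l, h with
    | a :: b :: l, h =>
      rw [Fin.sum_univ_succ, descents, ← ih (b :: l) (by simpa using h)]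
      simp

/-- Expansion of `(X + 1) ^ ascents l` according to the first block in a decomposition of `l` into
increasing blocks. -/
theorem add_one_pow_ascents {l : List α} (hl : l ≠ []) :
    (X + 1 : ℤ[X]) ^ ascents l =
      ∑ k ∈ (Finset.range l.length).filter (fun k => (l.take (k + 1)).IsChain (· < ·)),
        X ^ k * (X + 1) ^ ascents (l.drop (k + 1)) := by
  induction l with
  | nil => exact absurd rfl hl
  | cons a l ih =>
    cases l with
    | nil => simp [ascents]
    | cons b l =>
      have ih := ih (by simp)
      rw [Finset.sum_filter] at ih ⊢
      rw [List.length_cons, Finset.sum_range_succ']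
      simp only [List.take_succ_cons, List.isChain_cons_cons, List.drop_succ_cons, List.take_zero,
        List.isChain_singleton, List.drop_zero, pow_zero, one_mul, if_true] at ih ⊢
      by_cases hab : a < b
      -- In the new factor `X + 1`, the term `1` cuts after `a` and the term `X` joins `a` to the
      -- first block of the tail. When `a` is not below `b`, only the cut is possible.
      · rw [ascents, if_pos hab, pow_add, pow_one, add_mul, one_mul, add_left_inj]
        conv_lhs => rw [ih]
        rw [Finset.mul_sum]
        refine Finset.sum_congr rfl fun k _ => ?_
        simp only [hab, true_and]
        split_ifs
        · ring
        · simp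
      · simp [ascents, hab]

end Descents

/-! ### Reversed words and the matching recursion. -/

section Words
variable {n : ℕ} {B : Finset (Finset (Fin n))} {U : Finset (Fin n)} {a : Fin n}

/-- The reversals of `B`-partial permutations. -/
def IsReverseBWord (B : Finset (Finset (Fin n))) : List (Fin n) → Prop
  | [] => True
  | a :: l => IsReverseBWord B l ∧ a ∉ l ∧
      ∃ I ∈ B, I ⊆ (a :: l).toFinset ∧ a ∈ I ∧ ∃ m ∈ I, ∀ b ∈ a :: l, b ≤ m

theorem IsReverseBWord.nodup {l : List (Fin n)} (h : IsReverseBWord B l) : l.Nodup := by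
  induction l with
  | nil => simp
  | cons a l ih => exact List.nodup_cons.2 ⟨h.2.1, ih h.1⟩

/-- For chordal `B`, prefixing an increasing block only requires that its letters are connected to
the largest letter of the whole word. -/
theorem isReverseBWord_append (hB : IsChordal B) {l r : List (Fin n)}
    (hl : l.IsChain (· < ·)) : IsReverseBWord B (l ++ r) ↔
      IsReverseBWord B r ∧ (l ++ r).Nodup ∧ ∀ c ∈ l, ∃ I ∈ B, I ⊆ (l ++ r).toFinset ∧ c ∈ I ∧
        ∃ m ∈ I, ∀ b ∈ l ++ r, b ≤ m := by
  induction l with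
  | nil => simpa using fun h : IsReverseBWord B r => h.nodup
  | cons a l ih =>
    have hlt := (List.pairwise_cons.1 hl.pairwise).1
    rw [List.cons_append, IsReverseBWord, ih hl.tail]
    constructor
    · rintro ⟨⟨h1, h2, h3⟩, h4, h5⟩
      refine ⟨h1, List.nodup_cons.2 ⟨h4, h2⟩, fun c hc => ?_⟩
      rcases List.mem_cons.1 hc with rfl | hcl
      · exact h5
      · obtain ⟨I, hI, hIs, hcI, m, hm, hmax⟩ := h3 c hcl
        refine ⟨I, hI, hIs.trans fun x => by simp +contextual, hcI, m, hm, fun b hb => ?_⟩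
        rcases List.mem_cons.1 hb with rfl | hb
        · exact (hlt c hcl).le.trans (hmax c (by simp [hcl]))
        · exact hmax b hb
    · rintro ⟨h1, h2, h3⟩
      refine ⟨⟨h1, (List.nodup_cons.1 h2).2, fun c hc => ?_⟩, (List.nodup_cons.1 h2).1,
        h3 a (by simp)⟩
      obtain ⟨I, hI, hIs, hcI, m, hm, hmax⟩ := h3 c (List.mem_cons_of_mem _ hc)
      -- Chordality: keeping only the elements of `I` that are at least `c` discards `a < c` but
      -- keeps `c` and the maximum `m`.
      refine ⟨_, hB I hI c hcI, fun x hx => ?_, by simp [hcI], m, ?_, fun b hb =>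
        hmax b (List.mem_cons_of_mem _ hb)⟩
      · rw [Finset.mem_filter] at hx
        have := hIs hx.1
        rw [List.mem_toFinset, List.mem_cons] at this
        exact List.mem_toFinset.2 (this.resolve_left ((hlt c hc).trans_le hx.2).ne')
      · exact Finset.mem_filter.2 ⟨hm, hmax c (by simp [hc])⟩

open Classical in
/-- The reversed `B`-partial permutations with set of letters `U`. -/
noncomputable def reverseBWords (B : Finset (Finset (Fin n))) (U : Finset (Fin n)) :
    Finset (List (Fin n)) :=
  U.val.lists.toFinset.filter (IsReverseBWord B)

theorem mem_reverseBWords {l : List (Fin n)} :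
    l ∈ reverseBWords B U ↔ IsReverseBWord B l ∧ l.toFinset = U := by
  simp only [reverseBWords, Finset.mem_filter, Multiset.mem_toFinset, Multiset.mem_lists_iff]
  rw [and_comm]
  refine and_congr_right fun h => ?_
  rw [Multiset.quot_mk_to_coe, eq_comm, ← Finset.val_inj, List.toFinset_val, h.nodup.dedup]

/-- The descent generating polynomial, in `X + 1`, of the `B`-partial permutations with set of
letters `U`. -/
noncomputable def wordPoly (B : Finset (Finset (Fin n))) (U : Finset (Fin n)) : ℤ[X] :=
  ∑ l ∈ reverseBWords B U, (X + 1) ^ ascents l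

theorem wordPoly_empty : wordPoly B ∅ = 1 := by
  have : reverseBWords B ∅ = {[]} := by
    ext l
    rw [mem_reverseBWords, List.toFinset_eq_empty_iff, Finset.mem_singleton]
    exact ⟨fun h => h.2, fun h => ⟨h ▸ trivial, h⟩⟩
  simp [wordPoly, this, ascents]

/-- The maximum of the whole word is `a`, so being connected to it means lying in its component; the
order of the block is forced, and only its set of letters matters. -/
theorem append_mem_reverseBWords (hB : IsChordal B) (ha : a ∈ U) (hmax : ∀ b ∈ U, b ≤ a)
    {l r : List (Fin n)} (hl : l.IsChain (· < ·)) : l ++ r ∈ reverseBWords B U ↔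
      l.toFinset ⊆ component B U a ∧ r ∈ reverseBWords B (U \ l.toFinset) := by
  have hlnd : l.Nodup := hl.pairwise.imp fun h => h.ne
  rw [mem_reverseBWords, mem_reverseBWords, isReverseBWord_append hB hl]
  constructor
  · rintro ⟨⟨h1, h2, h3⟩, h4⟩
    refine ⟨fun c hc => ?_, h1, ?_⟩
    · obtain ⟨I, hI, hIs, hcI, m, hm, hm'⟩ := h3 c (List.mem_toFinset.1 hc)
      rw [h4] at hIs
      have : m = a := le_antisymm (hmax m (hIs hm)) (hm' a (List.mem_toFinset.1 (h4 ▸ ha)))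
      exact mem_component_iff.2 ⟨I, hI, hIs, this ▸ hm, hcI⟩
    · rw [← h4, List.toFinset_append, Finset.union_sdiff_cancel_left]
      rw [List.disjoint_toFinset_iff_disjoint]
      exact List.disjoint_of_nodup_append h2
  · rintro ⟨h1, h2, h3⟩
    have h4 : (l ++ r).toFinset = U := by
      rw [List.toFinset_append, h3, Finset.union_sdiff_of_subset (h1.trans component_subset)]
    refine ⟨⟨h2, hlnd.append h2.nodup ?_, fun c hc => ?_⟩, h4⟩
    · rw [← List.disjoint_toFinset_iff_disjoint, h3]
      exact Finset.disjoint_sdiff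
    · obtain ⟨I, hI, hIU, haI, hcI⟩ := mem_component_iff.1 (h1 (List.mem_toFinset.2 hc))
      exact ⟨I, hI, h4 ▸ hIU, hcI, a, haI, fun b hb => hmax b (h4 ▸ List.mem_toFinset.2 hb)⟩

/-- Removing the last block from the words with set of letters `U`. -/
theorem wordPoly_eq (hB : IsChordal B) (ha : a ∈ U) (hmax : ∀ b ∈ U, b ≤ a) :
    wordPoly B U = ∑ C ∈ (component B U a).powerset.erase ∅,
      X ^ (C.card - 1) * wordPoly B (U \ C) := by
  have hne : ∀ l ∈ reverseBWords B U, l ≠ [] := by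
    rintro l hl rfl
    rw [← (mem_reverseBWords.1 hl).2] at ha
    simp at ha
  have hsort : ∀ C : Finset (Fin n), (C.sort).IsChain (· < ·) := fun C =>
    (Finset.sortedLT_sort C).isChain
  rw [wordPoly, Finset.sum_congr rfl fun l hl => add_one_pow_ascents (hne l hl)]
  simp only [wordPoly, Finset.mul_sum]
  rw [Finset.sum_sigma', Finset.sum_sigma']
  have hcard : ∀ l : List (Fin n), ∀ k < l.length, (l.take (k + 1)).IsChain (· < ·) →
      (l.take (k + 1)).toFinset.card = k + 1 := by
    intro l k hk h
    rw [List.toFinset_card_of_nodup (h.pairwise.imp fun h => h.ne), List.length_take]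
    omega
  refine Finset.sum_bij'
    (fun p _ => (⟨(p.1.take (p.2 + 1)).toFinset, p.1.drop (p.2 + 1)⟩ :
      (_ : Finset (Fin n)) × List (Fin n)))
    -- An increasing block is recovered from its letters by sorting; the index is one less than the
    -- block length.
    (fun q _ => (⟨q.1.sort ++ q.2, q.1.card - 1⟩ : (_ : List (Fin n)) × ℕ)) ?_ ?_ ?_ ?_ ?_
  · rintro ⟨l, k⟩ hp
    simp only [Finset.mem_sigma, Finset.mem_filter, Finset.mem_range, Finset.mem_erase,
      Finset.mem_powerset] at hp ⊢
    obtain ⟨hl, hk, hch⟩ := hp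
    rw [← List.take_append_drop (k + 1) l, append_mem_reverseBWords hB ha hmax hch] at hl
    refine ⟨⟨Finset.card_pos.1 ?_ |>.ne_empty, hl.1⟩, hl.2⟩
    rw [hcard l k hk hch]
    omega
  · rintro ⟨C, r⟩ hq
    simp only [Finset.mem_sigma, Finset.mem_filter, Finset.mem_range, Finset.mem_erase,
      Finset.mem_powerset] at hq ⊢
    obtain ⟨⟨hC, hCK⟩, hr⟩ := hq
    have hpos := Finset.card_pos.2 (Finset.nonempty_iff_ne_empty.2 hC)
    rw [append_mem_reverseBWords hB ha hmax (hsort C), Finset.sort_toFinset]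
    refine ⟨⟨hCK, hr⟩, ?_, ?_⟩
    · rw [List.length_append, Finset.length_sort]
      omega
    · rw [List.take_left' (by rw [Finset.length_sort]; omega)]
      exact hsort C
  · rintro ⟨l, k⟩ hp
    simp only [Finset.mem_sigma, Finset.mem_filter, Finset.mem_range] at hp
    obtain ⟨hl, hk, hch⟩ := hp
    have h1 : (l.take (k + 1)).toFinset.sort = l.take (k + 1) :=
      (List.toFinset_sort (· ≤ ·) (hch.pairwise.imp fun h => h.ne)).2
        (hch.pairwise.imp fun h => h.le)
    simp only [h1, List.take_append_drop, hcard l k hk hch, Nat.add_sub_cancel]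
  · rintro ⟨C, r⟩ hq
    simp only [Finset.mem_sigma, Finset.mem_erase, Finset.mem_powerset] at hq
    have hpos := Finset.card_pos.2 (Finset.nonempty_iff_ne_empty.2 hq.1.1)
    have h1 : (C.sort).length = C.card - 1 + 1 := by rw [Finset.length_sort]; omega
    simp only [List.take_left' h1, List.drop_left' h1, Finset.sort_toFinset]
  · rintro ⟨l, k⟩ hp
    simp only [Finset.mem_sigma, Finset.mem_filter, Finset.mem_range] at hp
    obtain ⟨hl, hk, hch⟩ := hp
    simp only [hcard l k hk hch, Nat.add_sub_cancel]

/-- The recursion for nested collections holds at any point of `U`; the one for words needs the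
maximum and chordality, which dictates the choice here. -/
theorem nestedPoly_eq_wordPoly (hB : IsBuildingSet B) (hc : IsChordal B) (U : Finset (Fin n)) :
    nestedPoly B U = wordPoly B U := by
  induction U using Finset.strongInduction with
  | H U ih =>
    rcases U.eq_empty_or_nonempty with rfl | hU
    · rw [nestedPoly_empty hB, wordPoly_empty]
    · rw [nestedPoly_eq hB (U.max'_mem hU), wordPoly_eq hc (U.max'_mem hU) fun b hb =>
        U.le_max' b hb]
      refine Finset.sum_congr rfl fun C hC => ?_
      rw [Finset.mem_erase, Finset.mem_powerset] at hC
      rw [ih _ (Finset.sdiff_ssubset (hC.2.trans component_subset)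
        (Finset.nonempty_iff_ne_empty.2 hC.1))]

end Words

/-! ### Descents under the map to permutations, and the conclusion. -/

section Phi
variable {n : ℕ} {B : Finset (Finset (Fin n))}

theorem exists_phiWord_eq (w : PartialPerm n) : ∃ r : List (Fin (n + 1)),
    phiWord w = w.1.map Fin.castSucc ++ Fin.last n :: r ∧
      (Fin.last n :: r).Pairwise (· > ·) ∧ r.length + w.1.length = n := by
  set s := (Finset.univ \ (w.1.map Fin.castSucc).toFinset).sort (fun a b => b ≤ a) with hs
  have hphi : phiWord w = w.1.map Fin.castSucc ++ s := rfl
  have hpair : s.Pairwise (· > ·) :=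
    ((Finset.pairwise_sort _ _).and (Finset.sort_nodup _ _)).imp fun h => lt_of_le_of_ne h.1 h.2.symm
  have hlast : Fin.last n ∈ s := by
    rw [hs, Finset.mem_sort, Finset.mem_sdiff, List.mem_toFinset, List.mem_map]
    refine ⟨Finset.mem_univ _, ?_⟩
    rintro ⟨a, -, ha⟩
    exact (Fin.castSucc_lt_last a).ne ha
  have hlen := phiWord_length w
  rw [hphi, List.length_append, List.length_map] at hlen
  rw [hphi]
  cases h : s with
  | nil => simp [h] at hlast
  | cons b r =>
    rw [h] at hlast hpair hlen
    have hb : b = Fin.last n := by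
      rcases List.mem_cons.1 hlast with hl | hl
      · exact hl.symm
      · exact absurd ((List.pairwise_cons.1 hpair).1 _ hl) (Fin.le_last b).not_gt
    subst hb
    refine ⟨r, rfl, hpair, ?_⟩
    rw [List.length_cons] at hlen
    omega

/-- The appended part starts with the largest letter, so no descent occurs at the junction, and its
`n + 1 - k` decreasing letters contribute `n - k`, where `k` is the length of `w`. -/
theorem des_phi (w : PartialPerm n) :
    des (phi w) = descents w.1 + (n - w.1.length) := by
  have h1 : des (phi w) = descents (phiWord w) := by
    rw [← sum_ite_lt_eq_descents n _ (phiWord_length w), des, Finset.card_filter]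
    rfl
  obtain ⟨r, hr, hpair, hlen⟩ := exists_phiWord_eq w
  rw [h1, hr, descents_append_cons, descents_append_singleton fun a _ => Fin.le_last a,
    descents_of_pairwise hpair, descents_map (Fin.strictMono_castSucc), List.length_cons]
  omega

/-- The letter `Fin.last n` marks where `w` ends. -/
theorem phi_injective : Function.Injective (phi (n := n)) := by
  intro w w' h
  have hw : phiWord w = phiWord w' := by
    refine List.ext_getElem (by rw [phiWord_length, phiWord_length]) fun i h1 h2 => ?_
    have := congrArg (fun σ => σ ⟨i, by rwa [phiWord_length] at h1⟩) h
    simpa only [phi_apply] using this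
  obtain ⟨r, hr, hpair, -⟩ := exists_phiWord_eq w
  obtain ⟨r', hr', hpair', -⟩ := exists_phiWord_eq w'
  rw [hr, hr', List.append_cons_inj_of_notMem] at hw
  · exact Subtype.ext (List.map_injective_iff.2 (Fin.castSucc_injective n) hw.1)
  · rw [List.mem_map]
    rintro ⟨a, -, ha⟩
    exact (Fin.castSucc_lt_last a).ne ha
  · exact fun hm => lt_irrefl _ ((List.pairwise_cons.1 hpair).1 _ hm)

theorem forall_isGreatest_iff {l : List (Fin n)} {a : Fin n} :
    (∀ M, IsGreatest {b : Fin n | b ∈ a :: l} M →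
      SameComponent (restrict B (a :: l).toFinset) a M) ↔
      ∃ I ∈ B, I ⊆ (a :: l).toFinset ∧ a ∈ I ∧ ∃ m ∈ I, ∀ b ∈ a :: l, b ≤ m := by
  simp only [sameComponent_restrict_iff, mem_component_iff]
  constructor
  · intro h
    have hne : (a :: l).toFinset.Nonempty := ⟨a, by simp⟩
    obtain ⟨I, hI, hIs, haI, hm⟩ := h ((a :: l).toFinset.max' hne)
      ⟨List.mem_toFinset.1 (Finset.max'_mem _ hne), fun b hb =>
        Finset.le_max' _ _ (List.mem_toFinset.2 hb)⟩
    exact ⟨I, hI, hIs, haI, _, hm, fun b hb => Finset.le_max' _ _ (List.mem_toFinset.2 hb)⟩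
  · rintro ⟨I, hI, hIs, haI, m, hm, hmax⟩ M hM
    have : m = M := le_antisymm (hM.2 (List.mem_toFinset.1 (hIs hm))) (hmax M hM.1)
    exact ⟨I, hI, hIs, haI, this ▸ hm⟩

/-- Reversal turns the prefixes in the condition into suffixes, so it becomes structurally recursive
on lists. -/
theorem isBPartialPerm_iff (w : PartialPerm n) :
    IsBPartialPerm B w ↔ IsReverseBWord B w.1.reverse := by
  obtain ⟨w, hw⟩ := w
  induction w using List.reverseRecOn with
  | nil => simp [IsBPartialPerm, IsReverseBWord]
  | append_singleton l a ih =>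
    have hl : l.Nodup := hw.of_append_left
    have ha : a ∉ l := fun h => List.disjoint_of_nodup_append hw h (by simp)
    rw [List.reverse_append, List.reverse_singleton, List.singleton_append, IsReverseBWord,
      ← ih hl, ← forall_isGreatest_iff]
    simp only [List.mem_reverse, ha, not_false_eq_true, true_and]
    have hset : ({b | b ∈ l ++ [a]} : Set (Fin n)) = {b | b ∈ a :: l.reverse} := by
      ext b; simp [or_comm]
    have hfin : (l ++ [a]).toFinset = (a :: l.reverse).toFinset := by
      ext b; simp
    have htake : ∀ i < l.length, (l ++ [a]).take (i + 1) = l.take (i + 1) := fun i hi =>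
      List.take_append_of_le_length hi
    constructor
    · refine fun h => ⟨fun i hi M hM => ?_, fun M hM => ?_⟩
      · have := h i (by simp; simp at hi; omega) M
        simp only at hi this hM ⊢
        rw [htake i hi, List.getElem_append_left hi] at this
        exact this hM
      · have := h l.length (by simp) M
        simp only [List.getElem_concat_length] at this
        rw [List.take_of_length_le (by simp), hset, hfin] at this
        exact this hM
    · rintro ⟨h1, h2⟩ i hi M hM
      simp only [List.length_append, List.length_singleton] at hi hM ⊢
      rcases Nat.lt_succ_iff_lt_or_eq.1 hi with hi' | rfl
      · rw [htake i hi'] at hM ⊢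
        rw [List.getElem_append_left hi']
        exact h1 i hi' M hM
      · simp only [List.getElem_concat_length]
        rw [List.take_of_length_le (by simp)] at hM ⊢
        rw [hset] at hM
        rw [hfin]
        exact h2 M hM

theorem mem_extendedBPermutations {σ : Equiv.Perm (Fin (n + 1))} :
    σ ∈ extendedBPermutations B ↔ ∃ w, IsBPartialPerm B w ∧ phi w = σ := by
  simp [extendedBPermutations]

theorem sum_extendedBPermutations :
    ∑ σ ∈ extendedBPermutations B, (X + 1 : ℤ[X]) ^ des σ =
      ∑ U, (X + 1) ^ (n - U.card) * wordPoly B U := by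
  simp only [wordPoly, Finset.mul_sum]
  rw [Finset.sum_sigma']
  symm
  refine Finset.sum_bij (fun p hp => phi ⟨p.2.reverse, List.nodup_reverse.2
    (mem_reverseBWords.1 (Finset.mem_sigma.1 hp).2).1.nodup⟩) ?_ ?_ ?_ ?_
  · rintro ⟨U, l⟩ hp
    have hl := (mem_reverseBWords.1 (Finset.mem_sigma.1 hp).2).1
    refine mem_extendedBPermutations.2 ⟨_, ?_, rfl⟩
    rw [isBPartialPerm_iff, List.reverse_reverse]
    exact hl
  · rintro ⟨U, l⟩ hp ⟨U', l'⟩ hp' h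
    have hl := (mem_reverseBWords.1 (Finset.mem_sigma.1 hp).2).2
    have hl' := (mem_reverseBWords.1 (Finset.mem_sigma.1 hp').2).2
    obtain rfl : l = l' := List.reverse_injective (congrArg Subtype.val (phi_injective h))
    obtain rfl : U = U' := hl.symm.trans hl'
    rfl
  · intro σ hσ
    obtain ⟨w, hw, rfl⟩ := mem_extendedBPermutations.1 hσ
    refine ⟨⟨w.1.toFinset, w.1.reverse⟩, Finset.mem_sigma.2 ⟨Finset.mem_univ _,
      mem_reverseBWords.2 ⟨(isBPartialPerm_iff w).1 hw, List.toFinset_reverse⟩⟩, ?_⟩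
    congr 1
    exact Subtype.ext (List.reverse_reverse _)
  · rintro ⟨U, l⟩ hp
    obtain ⟨hl, hlU⟩ := mem_reverseBWords.1 (Finset.mem_sigma.1 hp).2
    simp only at hl hlU ⊢
    have hcard : U.card = l.length := by rw [← hlU, List.toFinset_card_of_nodup hl.nodup]
    rw [des_phi, descents_reverse, List.length_reverse, hcard, ← pow_add, Nat.add_comm]

theorem IsExtendedNestohedron.hPoly_eq (hB : IsBuildingSet B) (hc : IsChordal B) {m : ℕ}
    {P : Set (EuclideanSpace ℝ (Fin m))} (hP : IsExtendedNestohedron B P) :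
    hPoly P = ∑ w ∈ extendedBPermutations B, (X : ℤ[X]) ^ des w := by
  classical
  rw [hPoly, hP.fPoly_eq hB, sum_isExtendedNested hB,
    Finset.sum_congr rfl fun U _ => by rw [nestedPoly_eq_wordPoly hB hc U],
    ← sum_extendedBPermutations]
  simp [Polynomial.sum_comp]

end Phi
end ExtNest

theorem theorem6p9 (n : ℕ) (B : Finset (Finset (Fin n)))
    (hB : ExtNest.IsBuildingSet B) (hchordal : ExtNest.IsChordal B) :
    (∃ P : Set (EuclideanSpace ℝ (Fin n)), ExtNest.IsExtendedNestohedron B P) ∧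
      ∀ (m : ℕ) (P : Set (EuclideanSpace ℝ (Fin m))), ExtNest.IsExtendedNestohedron B P →
        ExtNest.hPoly P = ∑ w ∈ ExtNest.extendedBPermutations B,
          (Polynomial.X : Polynomial ℤ) ^ ExtNest.des w :=
  ⟨hB.exists_isExtendedNestohedron.imp fun _ h => h.1, fun _ _ hP => hP.hPoly_eq hB hchordal⟩
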